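/- **Conventions.** A positive, finite, Lebesgue measurable function $v$ on $(0,\infty)$ is *slowly varying*, $v\in SV(0,\infty)$, if for every $\varepsilon>0$ the function $t^{\varepsilon}v(t)$ is equivalent (up to positive multiplicative constants, on all of $(0,\infty)$) to a non-decreasing function and $t^{-\varepsilon}v(t)$ is equivalent to a non-increasing function. $AC(0,\infty)$ is the set of functions that are absolutely continuous on every compact subinterval of $(0,\infty)$. For a monotone function $f$ on $(0,\infty)$ put $f(0)=\lim_{t\to0+}f(t)$, $f(\infty)=\lim_{t\to\infty}f(t)$. A compatible couple $(X_0,X_1)$ consists of two Banach spaces continuously embedded in one Hausdorff topological vector space. $X_0\cap X_1$ carries the norm $\max\{\|f\|_{X_0},\|f\|_{X_1}\}$ and $X_0+X_1$ the norm $\inf\{\|f_0\|_{X_0}+\|f_1\|_{X_1}: f=f_0+f_1\}$. For $t>0$ let $$K(f,t;X_0,X_1)=\inf\{\|f_0\|_{X_0}+t\|f_1\|_{X_1}: f=f_0+f_1,\ f_i\in X_i\}\quad (f\in X_0+X_1),$$ $$J(f,t;X_0,X_1)=\max\{\|f\|_{X_0},t\|f\|_{X_1}\}\quad (f\in X_0\cap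 X_1).$$ For a weight $v$ on $(0,\infty)$, $(X_0,X_1)_{0,\infty,v;K}$ is the set of all $f\in X_0+X_1$ with $$\|f\|_{0,\infty,v;K}=\operatorname*{ess\,sup}_{t>0}\,v(t)K(f,t;X_0,X_1)<\infty,$$ and $(X_0,X_1)_{0,\infty,v;J}$ is the set of all $f\in X_0+X_1$ with $$\|f\|_{0,\infty,v;J}=\inf_u\,\operatorname*{ess\,sup}_{t>0}\,v(t)J(u(t),t;X_0,X_1)<\infty,$$ where the infimum is over all strongly measurable $u:(0,\infty)\to X_0\cap X_1$ with $f=\int_0^\infty u(s)\,\frac{ds}{s}$ (Bochner integral convergent in $X_0+X_1$), and $\inf\emptyset=\infty$. An equality between such spaces means that they are equal as sets and that their norms are equivalent. The conventions $a/0=\infty$ for $a>0$ and $\infty\cdot0=0$ are used. **Theorem.** Let $(X_0,X_1)$ be a compatible couple and let $b\in SV(0,\infty)\cap AC(0,\infty)$ be strictly decreasing with $b(0)<\infty$ and $b(\infty)=0$. Let $\beta\in SV(0,\infty)\cap AC(0,\infty)$ be strictly decreasing with $\beta(0)=\infty$ and $\beta(\infty)=0$, and let $$B(x)=b(x)\ \text{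 if } x\in[1,\infty),\qquad B(x)=c\,\beta(x)\ \text{ if } x\in(0,1),$$ where $c>0$ is a constant chosen in such a way that $B\in AC(0,\infty)$. If $$A(x)=\frac{B^2(x)}{x\,(-B'(x))}\qquad\text{for a.a. } x>0,$$ then $$(X_0,X_1)_{0,\infty,b;K}=(X_0,X_0+X_1)_{0,\infty,B;K}=(X_0,X_0+X_1)_{0,\infty,A;J}.$$ -/

import Mathlib

open Set Filter MeasureTheory Topology
open scoped ENNReal

noncomputable section

namespace LimitingInterpolation

/-! ### Slowly varying and absolutely continuous functions on `(0, ∞)` -/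

/-- `f ≈ g` on `(0, ∞)`: each is bounded by a positive constant times the other. -/
def EquivOnPos (f g : ℝ → ℝ) : Prop :=
  ∃ c C : ℝ, 0 < c ∧ 0 < C ∧ ∀ t, 0 < t → c * g t ≤ f t ∧ f t ≤ C * g t

/-- `b ∈ SV(0, ∞)`: `b` is positive, finite and Lebesgue measurable on `(0, ∞)` and, for every
`ε > 0`, `t ^ ε * b t` is equivalent to a non-decreasing function on `(0, ∞)` and
`t ^ (-ε) * b t` is equivalent to a non-increasing function on `(0, ∞)`. -/
structure SlowlyVarying (b : ℝ → ℝ) : Prop where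
  pos : ∀ t, 0 < t → 0 < b t
  measurable : AEMeasurable b (volume.restrict (Ioi (0 : ℝ)))
  equiv_monotone : ∀ ε : ℝ, 0 < ε →
    ∃ g : ℝ → ℝ, MonotoneOn g (Ioi 0) ∧ EquivOnPos (fun t => t ^ ε * b t) g
  equiv_antitone : ∀ ε : ℝ, 0 < ε →
    ∃ g : ℝ → ℝ, AntitoneOn g (Ioi 0) ∧ EquivOnPos (fun t => t ^ (-ε) * b t) g

/-- `b ∈ AC(0, ∞)`: `b` is absolutely continuous on every compact subinterval of `(0, ∞)`.
(The class has to contain functions that tend to infinity at `0`, hence the local reading.) -/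
def AbsContPos (b : ℝ → ℝ) : Prop :=
  ∀ x y : ℝ, 0 < x → x ≤ y → AbsolutelyContinuousOnInterval b x y

/-! ### Compatible couples, their intersection and their sum

A compatible couple of Banach spaces `X₀`, `X₁` is given by two injective continuous linear maps
`i₀ : X₀ → E`, `i₁ : X₁ → E` into a Hausdorff topological vector space `E`. Scalars are real;
neither the spaces nor the norms below depend on the scalars, so that complex spaces are covered by
restriction of scalars. -/

section Couple

variable {X₀ X₁ E : Type*} [NormedAddCommGroup X₀] [NormedSpace ℝ X₀]
  [NormedAddCommGroup X₁] [NormedSpace ℝ X₁]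
  [AddCommGroup E] [Module ℝ E] [TopologicalSpace E] [IsTopologicalAddGroup E]

/-- The intersection `X₀ ∩ X₁`, as the space of pairs `(x₀, x₁)` with the same image in `E`. Its
norm is the one of the product, `max ‖x₀‖ ‖x₁‖`. -/
abbrev InterSpace (i₀ : X₀ →L[ℝ] E) (i₁ : X₁ →L[ℝ] E) : Type _ :=
  (LinearMap.eqLocus (i₀.toLinearMap ∘ₗ LinearMap.fst ℝ X₀ X₁)
    (i₁.toLinearMap ∘ₗ LinearMap.snd ℝ X₀ X₁) : Submodule ℝ (X₀ × X₁))

/-- The map `(x₀, x₁) ↦ x₀ + x₁` into `E`, where the product has norm `‖x₀‖ + ‖x₁‖`. -/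
def addMap (i₀ : X₀ →L[ℝ] E) (i₁ : X₁ →L[ℝ] E) : WithLp 1 (X₀ × X₁) →L[ℝ] E :=
  (i₀.coprod i₁) ∘L (WithLp.prodContinuousLinearEquiv 1 ℝ X₀ X₁).toContinuousLinearMap

/-- The pairs `(x₀, x₁)` with `x₀ + x₁ = 0` in `E`. -/
def addKer (i₀ : X₀ →L[ℝ] E) (i₁ : X₁ →L[ℝ] E) : Submodule ℝ (WithLp 1 (X₀ × X₁)) :=
  (addMap i₀ i₁).ker

instance isClosed_addKer [T2Space E] (i₀ : X₀ →L[ℝ] E) (i₁ : X₁ →L[ℝ] E) :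
    IsClosed (addKer i₀ i₁ : Set (WithLp 1 (X₀ × X₁))) :=
  (addMap i₀ i₁).isClosed_ker

/-- The sum `X₀ + X₁` as a Banach space: pairs `(x₀, x₁)`, identified when `x₀ + x₁` is the same
element of `E`, with the quotient norm `inf (‖x₀‖ + ‖x₁‖)` over all representing pairs. -/
abbrev SumSpace (i₀ : X₀ →L[ℝ] E) (i₁ : X₁ →L[ℝ] E) : Type _ :=
  WithLp 1 (X₀ × X₁) ⧸ addKer i₀ i₁

/-- The embedding of `X₀ + X₁` into `E`. -/
def sumEmb (i₀ : X₀ →L[ℝ] E) (i₁ : X₁ →L[ℝ] E) : SumSpace i₀ i₁ →L[ℝ] E :=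
  (addKer i₀ i₁).liftQL (addMap i₀ i₁) le_rfl

theorem sumEmb_injective (i₀ : X₀ →L[ℝ] E) (i₁ : X₁ →L[ℝ] E) :
    Function.Injective (sumEmb i₀ i₁) := by
  refine LinearMap.ker_eq_bot.1 ?_
  exact Submodule.ker_liftQ_eq_bot _ _ _ le_rfl

/-- The embedding of `X₀ ∩ X₁` into `X₀ + X₁`. -/
def interToSum (i₀ : X₀ →L[ℝ] E) (i₁ : X₁ →L[ℝ] E) (x : InterSpace i₀ i₁) : SumSpace i₀ i₁ :=
  Submodule.Quotient.mk (WithLp.toLp 1 (x.1.1, 0))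

/-! ### The functionals of Peetre -/

/-- The `K`-functional `K(f, t; X₀, X₁)`; it is `∞` for `f` outside `X₀ + X₁`. -/
def peetreK (i₀ : X₀ →L[ℝ] E) (i₁ : X₁ →L[ℝ] E) (f : E) (t : ℝ) : ℝ≥0∞ :=
  ⨅ (x₀ : X₀) (x₁ : X₁) (_ : i₀ x₀ + i₁ x₁ = f), ‖x₀‖ₑ + ENNReal.ofReal t * ‖x₁‖ₑ

/-- The `J`-functional `J(x, t; X₀, X₁)` for `x` in `X₀ ∩ X₁`. -/
def peetreJ (i₀ : X₀ →L[ℝ] E) (i₁ : X₁ →L[ℝ] E) (x : InterSpace i₀ i₁) (t : ℝ) : ℝ≥0∞ :=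
  max ‖x.1.1‖ₑ (ENNReal.ofReal t * ‖x.1.2‖ₑ)

/-! ### Interpolation spaces -/

/-- The weighted norm `‖t ^ (-θ - 1/q) v(t) F(t)‖_{q, (0, ∞)}`, with `1/∞ = 0`. -/
def weightedNorm (θ : ℝ) (q : ℝ≥0∞) (v F : ℝ → ℝ≥0∞) : ℝ≥0∞ :=
  eLpNorm (fun t => ENNReal.ofReal (t ^ (-θ - (q⁻¹).toReal)) * v t * F t) q
    (volume.restrict (Ioi (0 : ℝ)))

/-- A subset of the ambient space `E` with a functional that is its norm. -/
structure NormedSubset (E : Type*) where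
  carrier : Set E
  norm : E → ℝ≥0∞

/-- The two sets are equal and the two norms are equivalent on them. -/
def NormedSubset.Coincides {E : Type*} (Y Z : NormedSubset E) : Prop :=
  Y.carrier = Z.carrier ∧
    ∃ c C : ℝ, 0 < c ∧ 0 < C ∧ ∀ f ∈ Y.carrier,
      ENNReal.ofReal c * Y.norm f ≤ Z.norm f ∧ Z.norm f ≤ ENNReal.ofReal C * Y.norm f

/-- The space `(X₀, X₁)_{θ,q,v;K}`. -/
def spaceK (i₀ : X₀ →L[ℝ] E) (i₁ : X₁ →L[ℝ] E) (θ : ℝ) (q : ℝ≥0∞) (v : ℝ → ℝ≥0∞) :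
    NormedSubset E where
  carrier := {f | f ∈ range (sumEmb i₀ i₁) ∧ weightedNorm θ q v (peetreK i₀ i₁ f) < ∞}
  norm f := weightedNorm θ q v (peetreK i₀ i₁ f)

variable [T2Space E]

/-- `u : (0, ∞) → X₀ ∩ X₁` is strongly measurable and `f = ∫₀^∞ u(s) ds/s`, as an (absolutely)
convergent Bochner integral in `X₀ + X₁`. -/
structure Represents (i₀ : X₀ →L[ℝ] E) (i₁ : X₁ →L[ℝ] E) (u : ℝ → InterSpace i₀ i₁) (f : E) :
    Prop where
  measurable : AEStronglyMeasurable u (volume.restrict (Ioi (0 : ℝ)))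
  integrable : IntegrableOn (fun s => s⁻¹ • interToSum i₀ i₁ (u s)) (Ioi (0 : ℝ))
  integral_eq : sumEmb i₀ i₁ (∫ s in Ioi (0 : ℝ), s⁻¹ • interToSum i₀ i₁ (u s)) = f

/-- The norm of `(X₀, X₁)_{θ,q,v;J}`; it is `∞` if `f` has no representation. -/
def normJ (i₀ : X₀ →L[ℝ] E) (i₁ : X₁ →L[ℝ] E) (θ : ℝ) (q : ℝ≥0∞) (v : ℝ → ℝ≥0∞) (f : E) :
    ℝ≥0∞ :=
  ⨅ (u : ℝ → InterSpace i₀ i₁) (_ : Represents i₀ i₁ u f),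
    weightedNorm θ q v (fun t => peetreJ i₀ i₁ (u t) t)

/-- The space `(X₀, X₁)_{θ,q,v;J}`. -/
def spaceJ (i₀ : X₀ →L[ℝ] E) (i₁ : X₁ →L[ℝ] E) (θ : ℝ) (q : ℝ≥0∞) (v : ℝ → ℝ≥0∞) :
    NormedSubset E where
  carrier := {f | f ∈ range (sumEmb i₀ i₁) ∧ normJ i₀ i₁ θ q v f < ∞}
  norm f := normJ i₀ i₁ θ q v f

end Couple

end LimitingInterpolation

end

noncomputable section

namespace LimitingInterpolation

/-! ### Absolutely continuous and slowly varying functions -/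

/-! Put `G = 1/B`. Then `G' = -B'/B²`, so the two weights are `B = 1/G` and `A = 1/(x G')`. The
function `G` increases from `0` to `∞` (the graft `cβ` near `0` forces `G(0) = 0`), and slow
variation gives `G r ≤ C √(r/t) G t` for `t ≤ r`. These properties are collected in `IsGrowth`.

First equality: for `t ≥ 1` the K-functionals of `(X₀, X₁)` and `(X₀, X₀ + X₁)` are equivalent and
the weights agree. For `t < 1` both sides are controlled by `K(f, 1; X₀, X₁)`, because `b` and `t
B(t)` are bounded there (`spaceK_coincides_spaceK_sum`).

Second equality, valid for any couple and any growth function (`IsGrowth.spaceK_coincides_spaceJ`):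
J into K: split `f = ∫ u ds/s` at `t`. The two pieces are bounded by `∫₀ᵗ G'` and `t ∫ₜ^∞ G'(s)/s
ds`, and both are at most a constant times `G t`. K into J: discretize at the points `x_k` with
`G(x_k) = 2^k`, take differences of near-optimal decompositions of `f` at these points, and spread
the k-th difference over `(x_k, x_{k+1}]` with density `2^(-k) G'`. This density has mass one and
exactly cancels the weight `1/(s G')`. -/

theorem AbsContPos.continuousOn {f : ℝ → ℝ} (hf : AbsContPos f) : ContinuousOn f (Ioi 0) := by
  intro x hx
  have hx : 0 < x := hx
  have h := (hf (x / 2) (2 * x) (by linarith) (by linarith)).continuousOn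
  rw [uIcc_of_le (by linarith)] at h
  exact (h.continuousAt (Icc_mem_nhds (by linarith) (by linarith))).continuousWithinAt

/-- Inversion is Lipschitz on `[m, ∞)` with constant `1/m²`. -/
theorem absolutelyContinuousOnInterval_inv {f : ℝ → ℝ} {x y m : ℝ} (hm : 0 < m)
    (hf : AbsolutelyContinuousOnInterval f x y) (hfm : ∀ t ∈ uIcc x y, m ≤ f t) :
    AbsolutelyContinuousOnInterval (fun t => (f t)⁻¹) x y := by
  rw [absolutelyContinuousOnInterval_iff] at hf ⊢
  intro ε hε
  obtain ⟨δ, hδ, h⟩ := hf (ε * m ^ 2) (by positivity)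
  refine ⟨δ, hδ, fun E hE hlen => ?_⟩
  have h1 := h E hE hlen
  have h2 : ∀ i ∈ Finset.range E.1, dist (f (E.2 i).1)⁻¹ (f (E.2 i).2)⁻¹ ≤
      dist (f (E.2 i).1) (f (E.2 i).2) / m ^ 2 := by
    intro i hi
    obtain ⟨ha, hb⟩ := hE.1 i hi
    have ha := hfm _ ha
    have hb := hfm _ hb
    have ha0 := hm.le.trans ha
    rw [dist_inv_inv₀ (by linarith) (by linarith)]
    rw [Real.norm_of_nonneg (by linarith), Real.norm_of_nonneg (by linarith), sq]
    gcongr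
  refine (Finset.sum_le_sum h2).trans_lt ?_
  rw [← Finset.sum_div, div_lt_iff₀ (by positivity)]
  exact h1

/-- The exponent `1/2` is a convenience; any exponent in `(0, 1)` would give the sublinear growth
needed for `1/B`. -/
theorem SlowlyVarying.sqrt_quasi_monotone {b : ℝ → ℝ} (hb : SlowlyVarying b) :
    ∃ C : ℝ, 0 < C ∧ ∀ t r, 0 < t → t ≤ r → √t * b t ≤ C * (√r * b r) := by
  obtain ⟨g, hg, c, C, hc, hC, h⟩ := hb.equiv_monotone (1 / 2) (by norm_num)
  refine ⟨C / c, by positivity, fun t r ht htr => ?_⟩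
  have hr := ht.trans_le htr
  rw [Real.sqrt_eq_rpow, Real.sqrt_eq_rpow]
  calc t ^ (1 / 2 : ℝ) * b t ≤ C * g t := (h t ht).2
    _ ≤ C * g r := by gcongr; exact hg ht hr htr
    _ = C / c * (c * g r) := by field_simp
    _ ≤ _ := mul_le_mul_of_nonneg_left (h r hr).1 (by positivity)

theorem SlowlyVarying.exists_mul_le {b : ℝ → ℝ} (hb : SlowlyVarying b) :
    ∃ C : ℝ, 0 < C ∧ ∀ t, 0 < t → t ≤ 1 → t * b t ≤ C := by
  obtain ⟨C, hC, h⟩ := hb.sqrt_quasi_monotone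
  have hb1 := hb.pos 1 one_pos
  refine ⟨C * b 1, by positivity, fun t ht ht1 => ?_⟩
  have h1 : √t ≤ 1 := Real.sqrt_le_one.2 ht1
  have h2 := hb.pos t ht
  have h3 := h t 1 ht ht1
  rw [Real.sqrt_one, one_mul] at h3
  refine le_trans ?_ h3
  gcongr
  rw [Real.le_sqrt ht.le ht.le]
  nlinarith

/-! ### Growth functions -/

/-- An increasing locally absolutely continuous bijection of `(0, ∞)` that grows at most like the
square root. -/
structure IsGrowth (G : ℝ → ℝ) : Prop where
  pos : ∀ t, 0 < t → 0 < G t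
  strictMono : StrictMonoOn G (Ioi 0)
  absCont : AbsContPos G
  zero : Tendsto G (𝓝[>] 0) (𝓝 0)
  top : Tendsto G atTop atTop
  growth : ∃ C : ℝ, 0 < C ∧ ∀ t r, 0 < t → t ≤ r → G r ≤ C * √(r / t) * G t

namespace IsGrowth

variable {G : ℝ → ℝ}

theorem deriv_nonneg (hG : IsGrowth G) {x : ℝ} (hx : 0 < x) : 0 ≤ deriv G x := by
  rw [← derivWithin_of_isOpen isOpen_Ioi (mem_Ioi.2 hx)]
  exact hG.strictMono.monotoneOn.derivWithin_nonneg

theorem integrableOn_deriv (hG : IsGrowth G) {a b : ℝ} (ha : 0 < a) (hab : a ≤ b) :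
    IntegrableOn (deriv G) (Ioc a b) :=
  (intervalIntegrable_iff_integrableOn_Ioc_of_le hab).1
    (hG.absCont a b ha hab).intervalIntegrable_deriv

theorem integral_deriv (hG : IsGrowth G) {a b : ℝ} (ha : 0 < a) (hab : a ≤ b) :
    ∫ s in Ioc a b, deriv G s = G b - G a := by
  rw [← intervalIntegral.integral_of_le hab]
  exact (hG.absCont a b ha hab).integral_deriv_eq_sub

theorem lintegral_deriv_le (hG : IsGrowth G) {a b : ℝ} (ha : 0 < a) (hab : a ≤ b) :
    ∫⁻ s in Ioc a b, ENNReal.ofReal (deriv G s) ≤ ENNReal.ofReal (G b) := by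
  rw [← ofReal_integral_eq_lintegral_ofReal (hG.integrableOn_deriv ha hab), hG.integral_deriv ha hab]
  · exact ENNReal.ofReal_le_ofReal (by linarith [hG.pos a ha])
  · exact ae_restrict_of_forall_mem measurableSet_Ioc fun s hs => hG.deriv_nonneg (ha.trans hs.1)

/-- Absolute continuity is available only away from `0`, hence the exhaustion of `(0, t]` and
monotone convergence. -/
theorem lintegral_deriv_zero_le (hG : IsGrowth G) {t : ℝ} (ht : 0 < t) :
    ∫⁻ s in Ioc 0 t, ENNReal.ofReal (deriv G s) ≤ ENNReal.ofReal (G t) := by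
  have hU : Ioc 0 t = ⋃ n : ℕ, Ioc (t / (n + 1)) t := by
    ext s
    simp only [mem_Ioc, mem_iUnion]
    constructor
    · rintro ⟨h0, h1⟩
      obtain ⟨n, hn⟩ := exists_nat_gt (t / s)
      refine ⟨n, ?_, h1⟩
      rw [div_lt_iff₀ h0] at hn
      rw [div_lt_iff₀ (by positivity)]
      linarith
    · rintro ⟨n, h0, h1⟩
      exact ⟨lt_trans (by positivity) h0, h1⟩
  have hmono : Monotone fun n : ℕ => Ioc (t / (n + 1 : ℝ)) t := by
    intro m n hmn
    refine Ioc_subset_Ioc_left ?_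
    gcongr
  rw [hU, setLIntegral_iUnion_of_directed _ hmono.directed_le]
  refine iSup_le fun n => hG.lintegral_deriv_le (by positivity) ?_
  exact div_le_self ht.le (by linarith [n.cast_nonneg (α := ℝ)])

/-- On `(4^n t, 4^(n+1) t]` one has `1/s ≤ 4^(-n)/t`, while `G'` has integral at most `G(4^(n+1) t)
≤ C 2^(n+1) G t`. The product decays like `2^(-n)`, so sublinear growth makes the series converge.
-/
theorem lintegral_inv_mul_deriv_le (hG : IsGrowth G) :
    ∃ C : ℝ, 0 < C ∧ ∀ t, 0 < t →
      ENNReal.ofReal t * ∫⁻ s in Ioi t, ENNReal.ofReal (s⁻¹ * deriv G s) ≤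
        ENNReal.ofReal (C * G t) := by
  obtain ⟨C, hC, h⟩ := hG.growth
  refine ⟨4 * C, by positivity, fun t ht => ?_⟩
  have hU : Ioi t ⊆ ⋃ n : ℕ, Ioc (4 ^ n * t) (4 ^ (n + 1) * t) := by
    intro s hs
    have hs : t < s := hs
    have hs0 : 0 < s := ht.trans hs
    obtain ⟨n, hn⟩ := exists_mem_Ioc_zpow (x := s / t) (y := (4 : ℝ)) (by positivity) (by norm_num)
    have hn0 : 0 ≤ n := by
      by_contra hneg
      have h1 : (4 : ℝ) ^ (n + 1) ≤ 4 ^ (0 : ℤ) := zpow_le_zpow_right₀ (by norm_num) (by omega)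
      have h2 := hn.2.trans h1
      rw [zpow_zero, div_le_one ht] at h2
      linarith
    lift n to ℕ using hn0
    have h1 := hn.1
    have h2 := hn.2
    rw [lt_div_iff₀ ht, zpow_natCast] at h1
    rw [div_le_iff₀ ht, ← Nat.cast_succ, zpow_natCast] at h2
    exact mem_iUnion.2 ⟨n, h1, h2⟩
  have hpiece : ∀ n : ℕ, ∫⁻ s in Ioc (4 ^ n * t) (4 ^ (n + 1) * t),
      ENNReal.ofReal (s⁻¹ * deriv G s) ≤ ENNReal.ofReal (2 * C * G t / t * (1 / 2) ^ n) := by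
    intro n
    have hpos : 0 < 4 ^ n * t := by positivity
    calc ∫⁻ s in Ioc (4 ^ n * t) (4 ^ (n + 1) * t), ENNReal.ofReal (s⁻¹ * deriv G s)
        ≤ ∫⁻ s in Ioc (4 ^ n * t) (4 ^ (n + 1) * t),
            ENNReal.ofReal (4 ^ n * t)⁻¹ * ENNReal.ofReal (deriv G s) := by
          refine setLIntegral_mono' measurableSet_Ioc fun s hs => ?_
          rw [← ENNReal.ofReal_mul (by positivity)]
          have := hG.deriv_nonneg (hpos.trans hs.1)
          have := hs.1.le
          gcongr
      _ = ENNReal.ofReal (4 ^ n * t)⁻¹ *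
            ∫⁻ s in Ioc (4 ^ n * t) (4 ^ (n + 1) * t), ENNReal.ofReal (deriv G s) :=
          lintegral_const_mul' _ _ ENNReal.ofReal_ne_top
      _ ≤ ENNReal.ofReal (4 ^ n * t)⁻¹ * ENNReal.ofReal (G (4 ^ (n + 1) * t)) := by
          gcongr
          refine hG.lintegral_deriv_le hpos ?_
          gcongr <;> norm_num
      _ ≤ _ := by
          rw [← ENNReal.ofReal_mul (by positivity)]
          refine ENNReal.ofReal_le_ofReal ?_
          have h1 := h t (4 ^ (n + 1) * t) ht
            (le_mul_of_one_le_left ht.le (one_le_pow₀ (by norm_num)))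
          have h2 : √(4 ^ (n + 1) * t / t) = 2 ^ (n + 1) := by
            rw [mul_div_cancel_right₀ _ ht.ne', Real.sqrt_eq_iff_eq_sq (by positivity) (by positivity),
              ← pow_mul, mul_comm, pow_mul]
            norm_num
          rw [h2] at h1
          calc (4 ^ n * t)⁻¹ * G (4 ^ (n + 1) * t) ≤ (4 ^ n * t)⁻¹ * (C * 2 ^ (n + 1) * G t) := by
                gcongr
            _ = _ := by
                have h4 : (4 : ℝ) ^ n = 2 ^ n * 2 ^ n := by rw [← mul_pow]; norm_num
                rw [h4, one_div, inv_pow, pow_succ]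
                field_simp
  have hGt := hG.pos t ht
  calc ENNReal.ofReal t * ∫⁻ s in Ioi t, ENNReal.ofReal (s⁻¹ * deriv G s)
      ≤ ENNReal.ofReal t * ∑' n : ℕ, ENNReal.ofReal (2 * C * G t / t * (1 / 2) ^ n) := by
        gcongr
        exact (lintegral_mono_set hU).trans ((lintegral_iUnion_le _ _).trans
          (ENNReal.tsum_le_tsum hpiece))
    _ = ENNReal.ofReal (4 * C * G t) := by
        rw [← ENNReal.ofReal_tsum_of_nonneg (fun n => by positivity)
          (summable_geometric_two.mul_left _), tsum_mul_left, tsum_geometric_two,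
          ← ENNReal.ofReal_mul ht.le]
        congr 1
        field_simp
        ring

theorem surjOn (hG : IsGrowth G) {y : ℝ} (hy : 0 < y) : ∃ x, 0 < x ∧ G x = y := by
  obtain ⟨a, ha, hay⟩ : ∃ a, 0 < a ∧ G a < y :=
    ((eventually_mem_nhdsWithin (s := Ioi (0 : ℝ))).and (hG.zero.eventually_lt_const hy)).exists
  obtain ⟨b, hb, hby⟩ := ((eventually_ge_atTop a).and (hG.top.eventually_ge_atTop y)).exists
  obtain ⟨x, hx, hxy⟩ := intermediate_value_Icc hb
    (hG.absCont.continuousOn.mono fun t ht => ha.trans_le ht.1) ⟨hay.le, hby⟩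
  exact ⟨x, ha.trans_le hx.1, hxy⟩

/-- The points at which a growth function takes the values `2 ^ k`. -/
def dyadicPoint (hG : IsGrowth G) (k : ℤ) : ℝ :=
  (hG.surjOn (y := 2 ^ k) (by positivity)).choose

theorem dyadicPoint_pos (hG : IsGrowth G) (k : ℤ) : 0 < hG.dyadicPoint k :=
  (hG.surjOn (y := 2 ^ k) (by positivity)).choose_spec.1

theorem apply_dyadicPoint (hG : IsGrowth G) (k : ℤ) : G (hG.dyadicPoint k) = 2 ^ k :=
  (hG.surjOn (y := 2 ^ k) (by positivity)).choose_spec.2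

theorem dyadicPoint_strictMono (hG : IsGrowth G) : StrictMono hG.dyadicPoint := by
  intro j k hjk
  rw [← hG.strictMono.lt_iff_lt (hG.dyadicPoint_pos j) (hG.dyadicPoint_pos k),
    hG.apply_dyadicPoint, hG.apply_dyadicPoint]
  exact zpow_lt_zpow_right₀ one_lt_two hjk

theorem iUnion_Ioc_dyadicPoint (hG : IsGrowth G) :
    ⋃ k : ℤ, Ioc (hG.dyadicPoint k) (hG.dyadicPoint (k + 1)) = Ioi 0 := by
  ext s
  simp only [mem_iUnion, mem_Ioi]
  constructor
  · rintro ⟨k, hk⟩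
    exact (hG.dyadicPoint_pos k).trans hk.1
  · intro hs
    obtain ⟨k, hk⟩ := exists_mem_Ioc_zpow (hG.pos s hs) one_lt_two
    rw [← hG.apply_dyadicPoint, ← hG.apply_dyadicPoint] at hk
    exact ⟨k, (hG.strictMono.lt_iff_lt (hG.dyadicPoint_pos k) hs).1 hk.1,
      (hG.strictMono.le_iff_le hs (hG.dyadicPoint_pos (k + 1))).1 hk.2⟩

theorem pairwise_disjoint_Ioc_dyadicPoint (hG : IsGrowth G) :
    Pairwise (Function.onFun Disjoint
      fun k : ℤ => Ioc (hG.dyadicPoint k) (hG.dyadicPoint (k + 1))) :=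
  hG.dyadicPoint_strictMono.monotone.pairwise_disjoint_on_Ioc_succ

/-- Growth between `x_0` and `x_n` reads `2^n ≤ C √(x_n/x_0)`, so `x_n` grows at least like `4^n`.
This makes the `X₁`-parts of the decompositions vanish at infinity. -/
theorem exists_two_pow_div_dyadicPoint_le (hG : IsGrowth G) :
    ∃ C : ℝ, 0 < C ∧ ∀ n : ℕ, 2 ^ n / hG.dyadicPoint n ≤ C * (1 / 2) ^ n := by
  obtain ⟨C, hC, h⟩ := hG.growth
  have hx0 := hG.dyadicPoint_pos 0
  refine ⟨C ^ 2 / hG.dyadicPoint 0, by positivity, fun n => ?_⟩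
  have hx := hG.dyadicPoint_pos n
  have h1 := h _ _ hx0 (hG.dyadicPoint_strictMono.monotone (Int.natCast_nonneg n))
  rw [hG.apply_dyadicPoint, hG.apply_dyadicPoint, zpow_zero, mul_one, zpow_natCast] at h1
  have h2 : ((2 : ℝ) ^ n) ^ 2 ≤ C ^ 2 * (hG.dyadicPoint n / hG.dyadicPoint 0) := by
    rw [← Real.sq_sqrt (by positivity : 0 ≤ hG.dyadicPoint n / hG.dyadicPoint 0), ← mul_pow]
    gcongr
  rw [div_le_iff₀ hx, one_div, inv_pow, ← mul_le_mul_iff_of_pos_left (by positivity : (0:ℝ) < 2 ^ n)]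
  calc (2 : ℝ) ^ n * 2 ^ n = (2 ^ n) ^ 2 := by ring
    _ ≤ _ := h2
    _ = _ := by field_simp

end IsGrowth

/-! ### Telescoping series over the integers -/

/-- The geometric bounds give unconditional summability on each half-line; the sums are then read
off from telescoping partial sums. -/
theorem hasSum_int_telescope {V : Type*} [NormedAddCommGroup V] [CompleteSpace V] {φ : ℤ → V}
    {a : V} {C q : ℝ} (hq0 : 0 ≤ q) (hq1 : q < 1)
    (hpos : ∀ n : ℕ, ‖φ (n + 1) - φ n‖ ≤ C * q ^ n)
    (hneg : ∀ n : ℕ, ‖φ (-(n + 1) + 1) - φ (-(n + 1))‖ ≤ C * q ^ n)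
    (htop : Tendsto (fun n : ℕ => φ n) atTop (𝓝 a))
    (hbot : Tendsto (fun n : ℕ => φ (-n)) atTop (𝓝 0)) :
    HasSum (fun k => φ (k + 1) - φ k) a := by
  have hgeo : Summable fun n : ℕ => C * q ^ n := (summable_geometric_of_lt_one hq0 hq1).mul_left C
  have h1 : HasSum (fun n : ℕ => φ (n + 1) - φ n) (a - φ 0) := by
    rw [(Summable.of_norm_bounded hgeo hpos).hasSum_iff_tendsto_nat]
    refine (htop.sub_const (φ 0)).congr fun N => ?_
    have := Finset.sum_range_sub (fun n : ℕ => φ n) N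
    push_cast at this
    exact this.symm
  have h2 : HasSum (fun n : ℕ => φ (-(n + 1) + 1) - φ (-(n + 1))) (φ 0 - 0) := by
    rw [(Summable.of_norm_bounded hgeo hneg).hasSum_iff_tendsto_nat]
    refine (hbot.const_sub (φ 0)).congr fun N => ?_
    have := Finset.sum_range_sub' (fun n : ℕ => φ (-n)) N
    push_cast at this
    rw [neg_zero] at this
    rw [← this]
    refine Finset.sum_congr rfl fun n _ => ?_
    rw [neg_add_rev, neg_add_cancel_comm]
  have h3 := HasSum.of_nat_of_neg_add_one (f := fun k : ℤ => φ (k + 1) - φ k) h1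
    h2
  rwa [sub_zero, sub_add_cancel] at h3

theorem summable_norm_int {V : Type*} [NormedAddCommGroup V] {w : ℤ → V} {C q : ℝ}
    (hq0 : 0 ≤ q) (hq1 : q < 1) (hpos : ∀ n : ℕ, ‖w n‖ ≤ C * q ^ n)
    (hneg : ∀ n : ℕ, ‖w (-(n + 1))‖ ≤ C * q ^ n) : Summable fun k => ‖w k‖ := by
  have hgeo : Summable fun n : ℕ => C * q ^ n := (summable_geometric_of_lt_one hq0 hq1).mul_left C
  exact Summable.of_nat_of_neg_add_one (Summable.of_nonneg_of_le (fun _ => norm_nonneg _) hpos hgeo)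
    (Summable.of_nonneg_of_le (fun _ => norm_nonneg _) hneg hgeo)

/-! ### Weighted essential suprema and the `K`-functional -/

theorem weightedNorm_zero_top (v F : ℝ → ℝ≥0∞) :
    weightedNorm 0 ∞ v F = essSup (fun t => v t * F t) (volume.restrict (Ioi (0 : ℝ))) := by
  simp [weightedNorm, eLpNorm_exponent_top, eLpNormEssSup]

theorem weightedNorm_zero_top_le_iff {v F : ℝ → ℝ≥0∞} {M : ℝ≥0∞} :
    weightedNorm 0 ∞ v F ≤ M ↔ ∀ᵐ t ∂(volume.restrict (Ioi (0 : ℝ))), v t * F t ≤ M := by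
  rw [weightedNorm_zero_top]
  exact ⟨fun h => (ENNReal.ae_le_essSup _).mono fun t ht => ht.trans h, fun h => essSup_le_of_ae_le M h⟩

/-- An essential supremum says nothing at a prescribed point. As `K` is monotone in `t`, a good
point slightly to the right is enough. -/
theorem exists_mem_Ioo_of_ae {p : ℝ → Prop} (hp : ∀ᵐ t ∂(volume.restrict (Ioi (0 : ℝ))), p t)
    {a b : ℝ} (ha : 0 ≤ a) (hab : a < b) : ∃ t ∈ Ioo a b, p t := by
  have h1 : ∀ᵐ t ∂(volume.restrict (Ioo a b)), p t :=
    ae_restrict_of_ae_restrict_of_subset (fun t ht => ha.trans_lt ht.1) hp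
  have : (volume.restrict (Ioo a b)) ≠ 0 := by
    simp [Measure.restrict_eq_zero, hab]
  have : NeZero (volume.restrict (Ioo a b)) := ⟨this⟩
  obtain ⟨t, ht⟩ := (h1.and (ae_restrict_mem measurableSet_Ioo)).exists
  exact ⟨t, ht.2, ht.1⟩

section Couple

variable {X₀ X₁ E : Type*} [NormedAddCommGroup X₀] [NormedSpace ℝ X₀]
  [NormedAddCommGroup X₁] [NormedSpace ℝ X₁]
  [AddCommGroup E] [Module ℝ E] [TopologicalSpace E]
  {i₀ : X₀ →L[ℝ] E} {i₁ : X₁ →L[ℝ] E}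

theorem peetreK_le {f : E} {t : ℝ} {x₀ : X₀} {x₁ : X₁} (h : i₀ x₀ + i₁ x₁ = f) :
    peetreK i₀ i₁ f t ≤ ‖x₀‖ₑ + ENNReal.ofReal t * ‖x₁‖ₑ :=
  iInf₂_le_of_le x₀ x₁ (iInf_le _ h)

theorem le_peetreK {f : E} {t : ℝ} {M : ℝ≥0∞}
    (h : ∀ x₀ x₁, i₀ x₀ + i₁ x₁ = f → M ≤ ‖x₀‖ₑ + ENNReal.ofReal t * ‖x₁‖ₑ) :
    M ≤ peetreK i₀ i₁ f t :=
  le_iInf₂ fun x₀ x₁ => le_iInf fun hx => h x₀ x₁ hx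

theorem peetreK_mono (f : E) : Monotone (peetreK i₀ i₁ f) := fun _ _ hst =>
  le_peetreK fun _ _ hx => (peetreK_le hx).trans (by gcongr)

theorem exists_decomposition_of_peetreK_lt {f : E} {t M : ℝ} (ht : 0 < t)
    (h : peetreK i₀ i₁ f t < ENNReal.ofReal M) :
    ∃ x₀ x₁, i₀ x₀ + i₁ x₁ = f ∧ ‖x₀‖ ≤ M ∧ t * ‖x₁‖ ≤ M := by
  simp only [peetreK, iInf_lt_iff] at h
  obtain ⟨x₀, x₁, hx, hlt⟩ := h
  refine ⟨x₀, x₁, hx, ?_⟩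
  rw [← ofReal_norm, ← ofReal_norm, ← ENNReal.ofReal_mul ht.le,
    ← ENNReal.ofReal_add (norm_nonneg _) (by positivity)] at hlt
  have h1 := ENNReal.ofReal_lt_ofReal_iff'.1 hlt
  have := norm_nonneg x₀
  have : 0 ≤ t * ‖x₁‖ := by positivity
  constructor <;> linarith

/-! ### The embeddings into the sum -/

variable [IsTopologicalAddGroup E]

/-- The embedding of `X₀` into `X₀ + X₁`. -/
def toSumLeft (i₀ : X₀ →L[ℝ] E) (i₁ : X₁ →L[ℝ] E) : X₀ →L[ℝ] SumSpace i₀ i₁ :=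
  (addKer i₀ i₁).mkQL ∘L (WithLp.prodContinuousLinearEquiv 1 ℝ X₀ X₁).symm.toContinuousLinearMap ∘L
    ContinuousLinearMap.inl ℝ X₀ X₁

/-- The embedding of `X₁` into `X₀ + X₁`. -/
def toSumRight (i₀ : X₀ →L[ℝ] E) (i₁ : X₁ →L[ℝ] E) : X₁ →L[ℝ] SumSpace i₀ i₁ :=
  (addKer i₀ i₁).mkQL ∘L (WithLp.prodContinuousLinearEquiv 1 ℝ X₀ X₁).symm.toContinuousLinearMap ∘L
    ContinuousLinearMap.inr ℝ X₀ X₁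

theorem sumEmb_toSumLeft (x : X₀) : sumEmb i₀ i₁ (toSumLeft i₀ i₁ x) = i₀ x := by
  change i₀ x + i₁ 0 = i₀ x
  simp

theorem sumEmb_toSumRight (x : X₁) : sumEmb i₀ i₁ (toSumRight i₀ i₁ x) = i₁ x := by
  change i₀ 0 + i₁ x = i₁ x
  simp

theorem sumEmb_mk (x : WithLp 1 (X₀ × X₁)) :
    sumEmb i₀ i₁ (Submodule.Quotient.mk x) = i₀ x.fst + i₁ x.snd := rfl

theorem interToSum_eq_left (z : InterSpace i₀ i₁) :
    interToSum i₀ i₁ z = toSumLeft i₀ i₁ z.1.1 := rfl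

/-- With `interToSum_eq_left`, this bounds the norm in the sum by whichever coordinate is small. -/
theorem interToSum_eq_right (z : InterSpace i₀ i₁) :
    interToSum i₀ i₁ z = toSumRight i₀ i₁ z.1.2 := by
  apply sumEmb_injective i₀ i₁
  rw [interToSum_eq_left, sumEmb_toSumLeft, sumEmb_toSumRight]
  exact z.2

theorem norm_toSumLeft_le [T2Space E] (x : X₀) : ‖toSumLeft i₀ i₁ x‖ ≤ ‖x‖ := by
  refine (Submodule.Quotient.norm_mk_le (addKer i₀ i₁) (WithLp.toLp 1 (x, 0))).trans ?_
  simp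

theorem norm_toSumRight_le [T2Space E] (x : X₁) : ‖toSumRight i₀ i₁ x‖ ≤ ‖x‖ := by
  refine (Submodule.Quotient.norm_mk_le (addKer i₀ i₁) (WithLp.toLp 1 (0, x))).trans ?_
  simp

variable [T2Space E]

/-! ### From the `J`-method to the `K`-method -/

/-- If `x = 0` the weight is `∞`, and finiteness of `M` forces `a = 0`; this covers points where `G'
= 0`. -/
theorem le_mul_of_inv_mul_le {a x M : ℝ≥0∞} (hx : x ≠ ∞) (hM : M ≠ ∞) (h : x⁻¹ * a ≤ M) :
    a ≤ M * x := by
  rcases eq_or_ne x 0 with rfl | hx0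
  · rw [ENNReal.inv_zero] at h
    have : a = 0 := by
      by_contra ha
      rw [ENNReal.top_mul ha] at h
      exact hM (top_le_iff.1 h)
    simp [this]
  · rw [mul_comm, ← div_eq_mul_inv] at h
    exact (ENNReal.div_le_iff hx0 hx).1 h

/-- The integral over `(0, t]` is taken in `X₀`, the one over `(t, ∞)` in `X₁`. They contribute the
summands `1` and `C` of the constant. -/
theorem IsGrowth.exists_peetreK_le_of_represents [CompleteSpace X₀] [CompleteSpace X₁]
    {G : ℝ → ℝ} (hG : IsGrowth G) :
    ∃ C : ℝ, 0 < C ∧ ∀ (f : E) (u : ℝ → InterSpace i₀ i₁) (M : ℝ≥0∞), M ≠ ∞ →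
      Represents i₀ i₁ u f →
      (∀ᵐ s ∂(volume.restrict (Ioi (0 : ℝ))),
        (ENNReal.ofReal (s * deriv G s))⁻¹ * peetreJ i₀ i₁ (u s) s ≤ M) →
      ∀ t, 0 < t → peetreK i₀ i₁ f t ≤ M * ENNReal.ofReal (C * G t) := by
  obtain ⟨C, hC, hint⟩ := hG.lintegral_inv_mul_deriv_le
  refine ⟨1 + C, by positivity, fun f u M hM hu hJ t ht => ?_⟩
  have hJ' : ∀ᵐ s ∂(volume.restrict (Ioi (0 : ℝ))),
      ‖s⁻¹ • (u s).1.1‖ₑ ≤ M * ENNReal.ofReal (deriv G s) ∧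
      ‖s⁻¹ • (u s).1.2‖ₑ ≤ M * ENNReal.ofReal (s⁻¹ * deriv G s) := by
    filter_upwards [hJ, ae_restrict_mem measurableSet_Ioi] with s hs hs0
    have hs0 : 0 < s := hs0
    have hle := le_mul_of_inv_mul_le ENNReal.ofReal_ne_top hM hs
    have h1 := (le_max_left _ _).trans hle
    have h2 := (le_max_right _ _).trans hle
    have hsi : ENNReal.ofReal s⁻¹ * ENNReal.ofReal s = 1 := by
      rw [← ENNReal.ofReal_mul (by positivity), inv_mul_cancel₀ hs0.ne', ENNReal.ofReal_one]
    rw [enorm_smul, enorm_smul, Real.enorm_of_nonneg (by positivity)]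
    rw [ENNReal.ofReal_mul hs0.le] at h1 h2
    rw [ENNReal.ofReal_mul (by positivity)]
    constructor
    · calc _ ≤ ENNReal.ofReal s⁻¹ * (M * (ENNReal.ofReal s * ENNReal.ofReal (deriv G s))) := by
            gcongr
        _ = (ENNReal.ofReal s⁻¹ * ENNReal.ofReal s) * (M * ENNReal.ofReal (deriv G s)) := by ring
        _ = _ := by rw [hsi, one_mul]
    · calc _ = ENNReal.ofReal s⁻¹ * (ENNReal.ofReal s⁻¹ * ENNReal.ofReal s) * ‖(u s).1.2‖ₑ := by
            rw [hsi, mul_one]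
        _ = ENNReal.ofReal s⁻¹ * ENNReal.ofReal s⁻¹ * (ENNReal.ofReal s * ‖(u s).1.2‖ₑ) := by ring
        _ ≤ ENNReal.ofReal s⁻¹ * ENNReal.ofReal s⁻¹ *
              (M * (ENNReal.ofReal s * ENNReal.ofReal (deriv G s))) := by gcongr
        _ = (ENNReal.ofReal s⁻¹ * ENNReal.ofReal s) *
              (M * (ENNReal.ofReal s⁻¹ * ENNReal.ofReal (deriv G s))) := by ring
        _ = _ := by rw [hsi, one_mul]
  have hsub0 : Ioc 0 t ⊆ Ioi (0 : ℝ) := fun s hs => hs.1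
  have hsub1 : Ioi t ⊆ Ioi (0 : ℝ) := Ioi_subset_Ioi ht.le
  have hinv : AEStronglyMeasurable (fun s : ℝ => s⁻¹) (volume.restrict (Ioi (0 : ℝ))) :=
    measurable_inv.aestronglyMeasurable
  have hmeas0 : AEStronglyMeasurable (fun s => s⁻¹ • (u s).1.1) (volume.restrict (Ioi (0 : ℝ))) :=
    hinv.smul ((continuous_fst.comp continuous_subtype_val).comp_aestronglyMeasurable hu.measurable)
  have hmeas1 : AEStronglyMeasurable (fun s => s⁻¹ • (u s).1.2) (volume.restrict (Ioi (0 : ℝ))) :=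
    hinv.smul ((continuous_snd.comp continuous_subtype_val).comp_aestronglyMeasurable hu.measurable)
  have hbound0 : ∫⁻ s in Ioc 0 t, ‖s⁻¹ • (u s).1.1‖ₑ ≤ M * ENNReal.ofReal (G t) :=
    calc ∫⁻ s in Ioc 0 t, ‖s⁻¹ • (u s).1.1‖ₑ
        ≤ ∫⁻ s in Ioc 0 t, M * ENNReal.ofReal (deriv G s) :=
          lintegral_mono_ae ((ae_restrict_of_ae_restrict_of_subset hsub0 hJ').mono fun s hs => hs.1)
      _ = M * ∫⁻ s in Ioc 0 t, ENNReal.ofReal (deriv G s) := lintegral_const_mul' _ _ hM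
      _ ≤ _ := by
          gcongr
          exact hG.lintegral_deriv_zero_le ht
  have hbound1 : ENNReal.ofReal t * ∫⁻ s in Ioi t, ‖s⁻¹ • (u s).1.2‖ₑ ≤
      M * ENNReal.ofReal (C * G t) :=
    calc ENNReal.ofReal t * ∫⁻ s in Ioi t, ‖s⁻¹ • (u s).1.2‖ₑ
        ≤ ENNReal.ofReal t * ∫⁻ s in Ioi t, M * ENNReal.ofReal (s⁻¹ * deriv G s) := by
          refine mul_le_mul_right ?_ _
          exact lintegral_mono_ae
            ((ae_restrict_of_ae_restrict_of_subset hsub1 hJ').mono fun s hs => hs.2)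
      _ = M * (ENNReal.ofReal t * ∫⁻ s in Ioi t, ENNReal.ofReal (s⁻¹ * deriv G s)) := by
          rw [lintegral_const_mul' _ _ hM]
          ring
      _ ≤ _ := by
          gcongr
          exact hint t ht
  have hfin1 : ∫⁻ s in Ioi t, ‖s⁻¹ • (u s).1.2‖ₑ < ∞ := by
    refine lt_top_iff_ne_top.2 fun htop => ?_
    rw [htop, ENNReal.mul_top (by simpa using ht)] at hbound1
    exact ENNReal.mul_ne_top hM ENNReal.ofReal_ne_top (top_le_iff.1 hbound1)
  have hI0 : IntegrableOn (fun s => s⁻¹ • (u s).1.1) (Ioc 0 t) :=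
    ⟨hmeas0.mono_measure (Measure.restrict_mono hsub0 le_rfl),
      hbound0.trans_lt (ENNReal.mul_lt_top hM.lt_top ENNReal.ofReal_lt_top)⟩
  have hI1 : IntegrableOn (fun s => s⁻¹ • (u s).1.2) (Ioi t) :=
    ⟨hmeas1.mono_measure (Measure.restrict_mono hsub1 le_rfl), hfin1⟩
  -- Each Bochner integral commutes with the embedding of its space into the sum, where the two add
  -- up to the representation of `f`.
  have hdec : i₀ (∫ s in Ioc 0 t, s⁻¹ • (u s).1.1) + i₁ (∫ s in Ioi t, s⁻¹ • (u s).1.2) = f := by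
    rw [← sumEmb_toSumLeft (i₀ := i₀) (i₁ := i₁), ← sumEmb_toSumRight (i₀ := i₀) (i₁ := i₁), ← map_add,
      ← ContinuousLinearMap.integral_comp_comm _ hI0, ← ContinuousLinearMap.integral_comp_comm _ hI1,
      ← hu.integral_eq, ← Ioc_union_Ioi_eq_Ioi ht.le,
      setIntegral_union (Ioc_disjoint_Ioi le_rfl) measurableSet_Ioi (hu.integrable.mono_set hsub0)
        (hu.integrable.mono_set hsub1)]
    simp only [map_smul, interToSum_eq_left]
    congr 3
    funext s
    rw [← interToSum_eq_right, interToSum_eq_left]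
  calc peetreK i₀ i₁ f t
      ≤ ‖∫ s in Ioc 0 t, s⁻¹ • (u s).1.1‖ₑ +
          ENNReal.ofReal t * ‖∫ s in Ioi t, s⁻¹ • (u s).1.2‖ₑ := peetreK_le hdec
    _ ≤ M * ENNReal.ofReal (G t) + M * ENNReal.ofReal (C * G t) := by
        refine add_le_add ((enorm_integral_le_lintegral_enorm _).trans hbound0) (le_trans ?_ hbound1)
        gcongr
        exact enorm_integral_le_lintegral_enorm _
    _ = M * ENNReal.ofReal ((1 + C) * G t) := by
        have := hG.pos t ht
        rw [← mul_add, ← ENNReal.ofReal_add this.le (by positivity)]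
        congr 2
        ring

end Couple

section Couple

variable {X₀ X₁ E : Type*} [NormedAddCommGroup X₀] [NormedSpace ℝ X₀]
  [NormedAddCommGroup X₁] [NormedSpace ℝ X₁]
  [AddCommGroup E] [Module ℝ E] [TopologicalSpace E]
  {i₀ : X₀ →L[ℝ] E} {i₁ : X₁ →L[ℝ] E}

/-! ### From the `K`-method to the `J`-method -/

/-- The function that equals `s G'(s) 2 ^ (-k) v k` between the `k`-th and the `k + 1`-st dyadic
point. -/
def IsGrowth.spread {G : ℝ → ℝ} (hG : IsGrowth G) (v : ℤ → InterSpace i₀ i₁) (s : ℝ) :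
    InterSpace i₀ i₁ :=
  open Classical in
  if h : ∃ k : ℤ, s ∈ Ioc (hG.dyadicPoint k) (hG.dyadicPoint (k + 1)) then
    (s * deriv G s * (2 ^ h.choose)⁻¹) • v h.choose
  else 0

theorem IsGrowth.spread_of_mem {G : ℝ → ℝ} (hG : IsGrowth G) (v : ℤ → InterSpace i₀ i₁) {s : ℝ}
    {k : ℤ} (hk : s ∈ Ioc (hG.dyadicPoint k) (hG.dyadicPoint (k + 1))) :
    hG.spread v s = (s * deriv G s * (2 ^ k)⁻¹) • v k := by
  have h : ∃ k : ℤ, s ∈ Ioc (hG.dyadicPoint k) (hG.dyadicPoint (k + 1)) := ⟨k, hk⟩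
  have heq : h.choose = k := by
    by_contra hne
    exact (Set.disjoint_left.1 (hG.pairwise_disjoint_Ioc_dyadicPoint hne)) h.choose_spec hk
  rw [IsGrowth.spread, dif_pos h, heq]

theorem IsGrowth.aestronglyMeasurable_spread {G : ℝ → ℝ} (hG : IsGrowth G)
    (v : ℤ → InterSpace i₀ i₁) :
    AEStronglyMeasurable (hG.spread v) (volume.restrict (Ioi (0 : ℝ))) := by
  rw [← hG.iUnion_Ioc_dyadicPoint, aestronglyMeasurable_iUnion_iff]
  intro k
  have hm : Measurable fun s => s * deriv G s * ((2 : ℝ) ^ k)⁻¹ :=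
    (measurable_id.mul (measurable_deriv G)).mul_const _
  exact (hm.aestronglyMeasurable.smul_const (v k)).congr
    (ae_restrict_of_forall_mem measurableSet_Ioc fun s hs => (hG.spread_of_mem v hs).symm)

theorem IsGrowth.inv_mul_peetreJ_spread_le {G : ℝ → ℝ} (hG : IsGrowth G)
    (v : ℤ → InterSpace i₀ i₁) {M : ℝ} (hv₀ : ∀ k, ‖(v k).1.1‖ ≤ 2 ^ k * M)
    (hv₁ : ∀ k, hG.dyadicPoint (k + 1) * ‖(v k).1.2‖ ≤ 2 ^ k * M) {s : ℝ} (hs : 0 < s) :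
    (ENNReal.ofReal (s * deriv G s))⁻¹ * peetreJ i₀ i₁ (hG.spread v s) s ≤ ENNReal.ofReal M := by
  obtain ⟨k, hk⟩ := mem_iUnion.1 (hG.iUnion_Ioc_dyadicPoint.symm ▸ mem_Ioi.2 hs)
  have hd : 0 ≤ s * deriv G s := mul_nonneg hs.le (hG.deriv_nonneg hs)
  have h2 : (0 : ℝ) < 2 ^ k := by positivity
  have hJ : peetreJ i₀ i₁ (hG.spread v s) s ≤
      ENNReal.ofReal (s * deriv G s) * ENNReal.ofReal M := by
    rw [hG.spread_of_mem v hk, ← ENNReal.ofReal_mul hd]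
    change max ‖(s * deriv G s * (2 ^ k)⁻¹) • (v k).1.1‖ₑ
      (ENNReal.ofReal s * ‖(s * deriv G s * (2 ^ k)⁻¹) • (v k).1.2‖ₑ) ≤ _
    rw [← ofReal_norm, ← ofReal_norm, ← ENNReal.ofReal_mul hs.le, norm_smul, norm_smul,
      Real.norm_of_nonneg (by positivity)]
    refine max_le (ENNReal.ofReal_le_ofReal ?_) (ENNReal.ofReal_le_ofReal ?_)
    · calc _ ≤ s * deriv G s * (2 ^ k)⁻¹ * (2 ^ k * M) := by gcongr; exact hv₀ k
        _ = _ := by field_simp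
    · calc s * (s * deriv G s * (2 ^ k)⁻¹ * ‖(v k).1.2‖)
          = s * deriv G s * (2 ^ k)⁻¹ * (s * ‖(v k).1.2‖) := by ring
        _ ≤ s * deriv G s * (2 ^ k)⁻¹ * (2 ^ k * M) := by
            refine mul_le_mul_of_nonneg_left ?_ (by positivity)
            exact (mul_le_mul_of_nonneg_right hk.2 (norm_nonneg _)).trans (hv₁ k)
        _ = _ := by field_simp
  calc _ ≤ (ENNReal.ofReal (s * deriv G s))⁻¹ *
        (ENNReal.ofReal (s * deriv G s) * ENNReal.ofReal M) := by gcongr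
    -- Only an inequality: where `G'(s) = 0` the product is `∞ * 0 = 0`.
    _ ≤ 1 * ENNReal.ofReal M := by
        rw [← mul_assoc]
        gcongr
        exact ENNReal.inv_mul_le_one _
    _ = _ := one_mul _

variable [IsTopologicalAddGroup E] [T2Space E]

/-- Since `2^(-k) G'` has mass one on the k-th interval, the integral over that interval is `v k`,
and its norm integrates to the norm of `v k`. Absolute summability then yields integrability on `(0,
∞)`. -/
theorem IsGrowth.represents_spread [CompleteSpace X₀] [CompleteSpace X₁] {G : ℝ → ℝ} (hG : IsGrowth G) (v : ℤ → InterSpace i₀ i₁)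
    (F : SumSpace i₀ i₁) (hv : HasSum (fun k => interToSum i₀ i₁ (v k)) F)
    (hvn : Summable fun k => ‖interToSum i₀ i₁ (v k)‖) :
    Represents i₀ i₁ (hG.spread v) (sumEmb i₀ i₁ F) := by
  have hle : ∀ k : ℤ, hG.dyadicPoint k ≤ hG.dyadicPoint (k + 1) := fun k =>
    (hG.dyadicPoint_strictMono (lt_add_one k)).le
  have hpiece : ∀ k : ℤ, EqOn (fun s => s⁻¹ • interToSum i₀ i₁ (hG.spread v s))
      (fun s => deriv G s • ((2 : ℝ) ^ k)⁻¹ • interToSum i₀ i₁ (v k))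
      (Ioc (hG.dyadicPoint k) (hG.dyadicPoint (k + 1))) := by
    intro k s hs
    have hs0 : s ≠ 0 := ((hG.dyadicPoint_pos k).trans hs.1).ne'
    simp only [hG.spread_of_mem v hs, interToSum_eq_left]
    change s⁻¹ • toSumLeft i₀ i₁ ((s * deriv G s * (2 ^ k)⁻¹) • (v k).1.1) = _
    rw [map_smul, smul_smul, smul_smul]
    congr 1
    field_simp
  have hmass : ∀ k : ℤ, ∫ s in Ioc (hG.dyadicPoint k) (hG.dyadicPoint (k + 1)), deriv G s = 2 ^ k := by
    intro k
    rw [hG.integral_deriv (hG.dyadicPoint_pos k) (hle k), hG.apply_dyadicPoint,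
      hG.apply_dyadicPoint, zpow_add_one₀ two_ne_zero]
    ring
  have hint : ∀ k : ℤ, IntegrableOn (fun s => s⁻¹ • interToSum i₀ i₁ (hG.spread v s))
      (Ioc (hG.dyadicPoint k) (hG.dyadicPoint (k + 1))) := fun k =>
    (integrableOn_congr_fun (hpiece k) measurableSet_Ioc).2
      ((hG.integrableOn_deriv (hG.dyadicPoint_pos k) (hle k)).smul_const _)
  have hval : ∀ k : ℤ, ∫ s in Ioc (hG.dyadicPoint k) (hG.dyadicPoint (k + 1)),
      s⁻¹ • interToSum i₀ i₁ (hG.spread v s) = interToSum i₀ i₁ (v k) := by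
    intro k
    rw [setIntegral_congr_fun measurableSet_Ioc (hpiece k), integral_smul_const, hmass, smul_smul,
      mul_inv_cancel₀ (by positivity), one_smul]
  have hnorm : ∀ k : ℤ, ∫ s in Ioc (hG.dyadicPoint k) (hG.dyadicPoint (k + 1)),
      ‖s⁻¹ • interToSum i₀ i₁ (hG.spread v s)‖ = ‖interToSum i₀ i₁ (v k)‖ := by
    intro k
    have : EqOn (fun s => ‖s⁻¹ • interToSum i₀ i₁ (hG.spread v s)‖)
        (fun s => deriv G s * (((2 : ℝ) ^ k)⁻¹ * ‖interToSum i₀ i₁ (v k)‖))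
        (Ioc (hG.dyadicPoint k) (hG.dyadicPoint (k + 1))) := by
      intro s hs
      have h1 := hpiece k hs
      simp only at h1 ⊢
      rw [h1, norm_smul, norm_smul,
        Real.norm_of_nonneg (hG.deriv_nonneg ((hG.dyadicPoint_pos k).trans hs.1)),
        Real.norm_of_nonneg (by positivity)]
    rw [setIntegral_congr_fun measurableSet_Ioc this, integral_mul_const, hmass, ← mul_assoc,
      mul_inv_cancel₀ (by positivity), one_mul]
  have hIU : IntegrableOn (fun s => s⁻¹ • interToSum i₀ i₁ (hG.spread v s))
      (⋃ k : ℤ, Ioc (hG.dyadicPoint k) (hG.dyadicPoint (k + 1))) := by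
    refine integrableOn_iUnion_of_summable_integral_norm hint ?_
    simpa only [hnorm] using hvn
  refine ⟨hG.aestronglyMeasurable_spread v, ?_, ?_⟩
  · rw [← hG.iUnion_Ioc_dyadicPoint]
    exact hIU
  · rw [← hG.iUnion_Ioc_dyadicPoint]
    have h := hasSum_integral_iUnion (fun _ => measurableSet_Ioc)
      hG.pairwise_disjoint_Ioc_dyadicPoint hIU
    simp only [hval] at h
    rw [h.unique hv]

theorem IsGrowth.exists_represents [CompleteSpace X₀] [CompleteSpace X₁] {G : ℝ → ℝ}
    (hG : IsGrowth G) (F : SumSpace i₀ i₁) {M : ℝ}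
    (hF : ∀ k, peetreK i₀ i₁ (sumEmb i₀ i₁ F) (hG.dyadicPoint k) < ENNReal.ofReal (2 ^ k * M)) :
    ∃ u, Represents i₀ i₁ u (sumEmb i₀ i₁ F) ∧ ∀ s, 0 < s →
      (ENNReal.ofReal (s * deriv G s))⁻¹ * peetreJ i₀ i₁ (u s) s ≤ ENNReal.ofReal (6 * M) := by
  choose y z hyz hy hz using fun k =>
    exists_decomposition_of_peetreK_lt (hG.dyadicPoint_pos k) (hF k)
  have hM : 0 ≤ M := by simpa using (norm_nonneg _).trans (hy 0)
  obtain ⟨C, hC, hdecay⟩ := hG.exists_two_pow_div_dyadicPoint_le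
  -- The indices are shifted by one because `s` runs up to `x_{k+1}` on the k-th interval and
  -- `x_{k+1}/x_k` has no upper bound. Decompositions at `x_{k+1}` and `x_{k+2}` cost `2 + 4 = 6`
  -- times `2^k M`.
  let v : ℤ → InterSpace i₀ i₁ := fun k => ⟨(y (k + 2) - y (k + 1), z (k + 1) - z (k + 2)), by
    change i₀ (y (k + 2) - y (k + 1)) = i₁ (z (k + 1) - z (k + 2))
    rw [map_sub, map_sub, sub_eq_sub_iff_add_eq_add, hyz, add_comm, hyz]⟩
  have hpow1 : ∀ k : ℤ, (2 : ℝ) ^ (k + 1) = 2 * 2 ^ k := fun k => by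
    rw [zpow_add_one₀ two_ne_zero, mul_comm]
  have hpow2 : ∀ k : ℤ, (2 : ℝ) ^ (k + 2) = 4 * 2 ^ k := fun k => by
    rw [zpow_add₀ two_ne_zero, mul_comm]
    norm_num
  have hv₀ : ∀ k, ‖(v k).1.1‖ ≤ 2 ^ k * (6 * M) := by
    intro k
    have h1 := hy (k + 1)
    have h2 := hy (k + 2)
    rw [hpow1] at h1
    rw [hpow2] at h2
    exact (norm_sub_le _ _).trans (by linarith)
  have hv₁ : ∀ k, hG.dyadicPoint (k + 1) * ‖(v k).1.2‖ ≤ 2 ^ k * (6 * M) := by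
    intro k
    have h1 := hz (k + 1)
    have h2 := hz (k + 2)
    rw [hpow1] at h1
    rw [hpow2] at h2
    have hx1 := hG.dyadicPoint_pos (k + 1)
    have hx : hG.dyadicPoint (k + 1) ≤ hG.dyadicPoint (k + 2) :=
      hG.dyadicPoint_strictMono.monotone (by omega)
    calc hG.dyadicPoint (k + 1) * ‖(v k).1.2‖
        ≤ hG.dyadicPoint (k + 1) * (‖z (k + 1)‖ + ‖z (k + 2)‖) := by
          gcongr
          exact norm_sub_le _ _
      _ = hG.dyadicPoint (k + 1) * ‖z (k + 1)‖ + hG.dyadicPoint (k + 1) * ‖z (k + 2)‖ := mul_add ..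
      _ ≤ hG.dyadicPoint (k + 1) * ‖z (k + 1)‖ + hG.dyadicPoint (k + 2) * ‖z (k + 2)‖ := by gcongr
      _ ≤ _ := by linarith
  have hφ : ∀ k : ℤ, interToSum i₀ i₁ (v k) =
      toSumLeft i₀ i₁ (y (k + 1 + 1)) - toSumLeft i₀ i₁ (y (k + 1)) := by
    intro k
    rw [interToSum_eq_left, ← map_sub, add_assoc]
    rfl
  -- Towards infinity the `X₁`-coordinate is small, towards zero the `X₀`-coordinate; `C + 1` is a
  -- common constant for both.
  have hpos : ∀ n : ℕ, ‖interToSum i₀ i₁ (v n)‖ ≤ 6 * M * (C + 1) * (1 / 2) ^ n := by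
    intro n
    have hx0 := hG.dyadicPoint_pos n
    have hx1 := hG.dyadicPoint_strictMono (lt_add_one (n : ℤ))
    rw [interToSum_eq_right]
    calc _ ≤ ‖(v n).1.2‖ := norm_toSumRight_le _
      _ ≤ 2 ^ n * (6 * M) / hG.dyadicPoint n := by
          rw [le_div_iff₀ hx0, mul_comm]
          have h := hv₁ n
          rw [zpow_natCast] at h
          exact le_trans (by gcongr) h
      _ = 6 * M * (2 ^ n / hG.dyadicPoint n) := by ring
      _ ≤ 6 * M * (C * (1 / 2) ^ n) := by gcongr; exact hdecay n
      _ ≤ 6 * M * ((C + 1) * (1 / 2) ^ n) := by gcongr; linarith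
      _ = _ := by ring
  have hhalf : ∀ n : ℕ, (2 : ℝ) ^ (-(n : ℤ)) = (1 / 2) ^ n := fun n => by
    rw [zpow_neg, zpow_natCast, one_div, inv_pow]
  have hneg : ∀ n : ℕ, ‖interToSum i₀ i₁ (v (-(n + 1)))‖ ≤ 6 * M * (C + 1) * (1 / 2) ^ n := by
    intro n
    rw [interToSum_eq_left]
    calc _ ≤ ‖(v (-(n + 1))).1.1‖ := norm_toSumLeft_le _
      _ ≤ 2 ^ (-(n + 1) : ℤ) * (6 * M) := hv₀ _
      _ ≤ 2 ^ (-(n : ℤ)) * (6 * M) := by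
          gcongr
          · norm_num
          · omega
      _ = 6 * M * 1 * (1 / 2) ^ n := by rw [hhalf]; ring
      _ ≤ _ := by gcongr; linarith
  have hgeo : Tendsto (fun n : ℕ => (1 / 2 : ℝ) ^ n) atTop (𝓝 0) :=
    tendsto_pow_atTop_nhds_zero_of_lt_one (by norm_num) (by norm_num)
  -- The error `F - y (n + 1)` is `z (n + 1)`, of norm at most `2^(n+1) M / x_{n+1}`.
  have htop : Tendsto (fun n : ℕ => toSumLeft i₀ i₁ (y (n + 1))) atTop (𝓝 F) := by
    rw [tendsto_iff_norm_sub_tendsto_zero]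
    have hlim : Tendsto (fun n : ℕ => M * (C * (1 / 2 : ℝ) ^ (n + 1))) atTop (𝓝 0) := by
      simpa using (((tendsto_add_atTop_iff_nat 1).2 hgeo).const_mul C).const_mul M
    refine squeeze_zero (fun _ => norm_nonneg _) (fun n => ?_) hlim
    have hF' : F = toSumLeft i₀ i₁ (y (n + 1)) + toSumRight i₀ i₁ (z (n + 1)) := by
      apply sumEmb_injective i₀ i₁
      rw [map_add, sumEmb_toSumLeft, sumEmb_toSumRight, hyz]
    have hx := hG.dyadicPoint_pos (n + 1)
    have h1 := hz (n + 1)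
    have h2 := hdecay (n + 1)
    push_cast at h2
    rw [← Nat.cast_succ, zpow_natCast] at h1
    calc _ = ‖toSumRight i₀ i₁ (z (n + 1))‖ := by
          rw [hF', sub_add_cancel_left, norm_neg]
      _ ≤ ‖z (n + 1)‖ := norm_toSumRight_le _
      _ ≤ 2 ^ (n + 1) * M / hG.dyadicPoint (n + 1) := by
          rw [le_div_iff₀ hx, mul_comm]
          exact h1
      _ = M * (2 ^ (n + 1) / hG.dyadicPoint (n + 1)) := by ring
      _ ≤ _ := by gcongr
  have hbot : Tendsto (fun n : ℕ => toSumLeft i₀ i₁ (y (-n + 1))) atTop (𝓝 0) := by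
    have hlim : Tendsto (fun n : ℕ => 2 * M * (1 / 2 : ℝ) ^ n) atTop (𝓝 0) := by
      simpa using hgeo.const_mul (2 * M)
    refine squeeze_zero_norm (fun n => ?_) hlim
    refine (norm_toSumLeft_le _).trans ((hy _).trans (le_of_eq ?_))
    rw [hpow1, hhalf]
    ring
  refine ⟨hG.spread v, hG.represents_spread v F ?_ ?_,
    fun s hs => hG.inv_mul_peetreJ_spread_le v hv₀ hv₁ hs⟩
  · have h := hasSum_int_telescope (φ := fun k : ℤ => toSumLeft i₀ i₁ (y (k + 1))) (a := F)
      (C := 6 * M * (C + 1)) (q := 1 / 2) (by norm_num) (by norm_num)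
      (fun n => by simpa only [hφ] using hpos n) (fun n => by simpa only [hφ] using hneg n) htop hbot
    simpa only [hφ] using h
  · exact summable_norm_int (by norm_num) (by norm_num) hpos hneg

theorem IsGrowth.spaceK_coincides_spaceJ [CompleteSpace X₀] [CompleteSpace X₁] {G : ℝ → ℝ}
    (hG : IsGrowth G) {A : ℝ → ℝ≥0∞}
    (hA : ∀ᵐ x ∂(volume.restrict (Ioi (0 : ℝ))), A x = (ENNReal.ofReal (x * deriv G x))⁻¹) :
    (spaceK i₀ i₁ 0 ∞ fun x => ENNReal.ofReal (G x)⁻¹).Coincides (spaceJ i₀ i₁ 0 ∞ A) := by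
  set v : ℝ → ℝ≥0∞ := fun x => ENNReal.ofReal (G x)⁻¹ with hv
  obtain ⟨C, hC, hKJ⟩ := hG.exists_peetreK_le_of_represents (i₀ := i₀) (i₁ := i₁)
  have hle : ∀ f, ENNReal.ofReal C⁻¹ * weightedNorm 0 ∞ v (peetreK i₀ i₁ f) ≤
      normJ i₀ i₁ 0 ∞ A f := by
    refine fun f => le_iInf₂ fun u hu => ?_
    set M := weightedNorm 0 ∞ A fun t => peetreJ i₀ i₁ (u t) t with hM
    rcases eq_or_ne M ∞ with htop | hfin
    · rw [htop]
      exact le_top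
    have hae : ∀ᵐ s ∂(volume.restrict (Ioi (0 : ℝ))),
        (ENNReal.ofReal (s * deriv G s))⁻¹ * peetreJ i₀ i₁ (u s) s ≤ M := by
      filter_upwards [hA, weightedNorm_zero_top_le_iff.1 hM.ge] with s h1 h2
      rwa [← h1]
    have hK := hKJ f u M hfin hu hae
    have hN : weightedNorm 0 ∞ v (peetreK i₀ i₁ f) ≤ ENNReal.ofReal C * M := by
      rw [weightedNorm_zero_top_le_iff]
      refine ae_restrict_of_forall_mem measurableSet_Ioi fun t ht => ?_
      have hGt := hG.pos t ht
      calc v t * peetreK i₀ i₁ f t ≤ ENNReal.ofReal (G t)⁻¹ * (M * ENNReal.ofReal (C * G t)) := by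
            gcongr
            exact hK t ht
        _ = M * (ENNReal.ofReal (G t)⁻¹ * ENNReal.ofReal (C * G t)) := by ring
        _ = _ := by
            rw [← ENNReal.ofReal_mul (by positivity), mul_comm]
            congr 2
            field_simp
    calc _ ≤ ENNReal.ofReal C⁻¹ * (ENNReal.ofReal C * M) := by gcongr
      _ = M := by
        rw [← mul_assoc, ← ENNReal.ofReal_mul (by positivity), inv_mul_cancel₀ hC.ne',
          ENNReal.ofReal_one, one_mul]
  have hge : ∀ f ∈ range (sumEmb i₀ i₁), weightedNorm 0 ∞ v (peetreK i₀ i₁ f) < ∞ →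
      normJ i₀ i₁ 0 ∞ A f ≤ ENNReal.ofReal 12 * weightedNorm 0 ∞ v (peetreK i₀ i₁ f) := by
    rintro f ⟨F, rfl⟩ hfin
    set N := weightedNorm 0 ∞ v (peetreK i₀ i₁ (sumEmb i₀ i₁ F)) with hN
    have hae := weightedNorm_zero_top_le_iff.1 hN.ge
    refine ENNReal.le_of_forall_pos_le_add fun ε hε _ => ?_
    -- The infimum in `K` need not be attained, so `N` is enlarged; `ε / 12` becomes `ε` after
    -- multiplication by `12 = 6 * 2`.
    have hNlt : N < ENNReal.ofReal (N.toReal + ε / 12) := by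
      refine (ENNReal.lt_ofReal_iff_toReal_lt hfin.ne).2 ?_
      have : (0 : ℝ) < ε := hε
      linarith
    have hpts : ∀ k : ℤ, peetreK i₀ i₁ (sumEmb i₀ i₁ F) (hG.dyadicPoint k) <
        ENNReal.ofReal (2 ^ k * (2 * (N.toReal + ε / 12))) := by
      intro k
      -- Moving right to a good point below `x_{k+1}` raises the bound from `2^k` to `2^(k+1)`: this
      -- is the factor `2`.
      obtain ⟨t, ⟨ht1, ht2⟩, ht⟩ := exists_mem_Ioo_of_ae hae (hG.dyadicPoint_pos k).le
        (hG.dyadicPoint_strictMono (lt_add_one k))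
      have ht0 := (hG.dyadicPoint_pos k).trans ht1
      have hGt := hG.pos t ht0
      have hGt2 := hG.strictMono.monotoneOn ht0 (hG.dyadicPoint_pos (k + 1)) ht2.le
      rw [hG.apply_dyadicPoint] at hGt2
      calc peetreK i₀ i₁ (sumEmb i₀ i₁ F) (hG.dyadicPoint k)
          ≤ peetreK i₀ i₁ (sumEmb i₀ i₁ F) t := peetreK_mono _ ht1.le
        _ ≤ N * ENNReal.ofReal (G t) := by
            refine le_mul_of_inv_mul_le ENNReal.ofReal_ne_top hfin.ne ?_
            rw [← ENNReal.ofReal_inv_of_pos hGt]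
            exact ht
        _ ≤ N * ENNReal.ofReal (2 ^ (k + 1)) := by gcongr
        _ < ENNReal.ofReal (N.toReal + ε / 12) * ENNReal.ofReal (2 ^ (k + 1)) := by
            refine (ENNReal.mul_lt_mul_iff_left ?_ ENNReal.ofReal_ne_top).2 hNlt
            rw [Ne, ENNReal.ofReal_eq_zero, not_le]
            positivity
        _ = _ := by
            rw [← ENNReal.ofReal_mul (by positivity), zpow_add_one₀ two_ne_zero]
            congr 1
            ring
    obtain ⟨u, hu, huJ⟩ := hG.exists_represents F hpts
    calc normJ i₀ i₁ 0 ∞ A (sumEmb i₀ i₁ F)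
        ≤ weightedNorm 0 ∞ A fun t => peetreJ i₀ i₁ (u t) t := iInf₂_le u hu
      _ ≤ ENNReal.ofReal (6 * (2 * (N.toReal + ε / 12))) := by
          rw [weightedNorm_zero_top_le_iff]
          filter_upwards [hA, ae_restrict_mem measurableSet_Ioi] with s h1 h2
          rw [h1]
          exact huJ s h2
      _ = ENNReal.ofReal 12 * N + ε := by
          have : 6 * (2 * (N.toReal + ε / 12)) = 12 * N.toReal + ε := by ring
          rw [this, ENNReal.ofReal_add (by positivity) ε.coe_nonneg, ENNReal.ofReal_mul (by norm_num),
            ENNReal.ofReal_toReal hfin.ne, ENNReal.ofReal_coe_nnreal]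
  refine ⟨?_, C⁻¹, 12, by positivity, by norm_num, fun f hf => ⟨hle f, hge f hf.1 hf.2⟩⟩
  ext f
  constructor
  · rintro ⟨h1, h2⟩
    exact ⟨h1, (hge f h1 h2).trans_lt (ENNReal.mul_lt_top ENNReal.ofReal_lt_top h2)⟩
  · rintro ⟨h1, h2⟩
    refine ⟨h1, lt_top_iff_ne_top.2 fun htop => ?_⟩
    have h3 := hle f
    rw [htop, ENNReal.mul_top (by simpa using hC)] at h3
    exact h2.not_ge h3

end Couple

/-! ### The couple `(X₀, X₀ + X₁)` -/

section Couple

variable {X₀ X₁ E : Type*} [NormedAddCommGroup X₀] [NormedSpace ℝ X₀]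
  [NormedAddCommGroup X₁] [NormedSpace ℝ X₁]
  [AddCommGroup E] [Module ℝ E] [TopologicalSpace E] [IsTopologicalAddGroup E]
  {i₀ : X₀ →L[ℝ] E} {i₁ : X₁ →L[ℝ] E}

variable [T2Space E]

theorem range_sumEmb_sum : range (sumEmb i₀ (sumEmb i₀ i₁)) = range (sumEmb i₀ i₁) := by
  apply Subset.antisymm
  · rintro _ ⟨F, rfl⟩
    obtain ⟨p, rfl⟩ := Submodule.Quotient.mk_surjective _ F
    exact ⟨toSumLeft i₀ i₁ p.fst + p.snd, by rw [map_add, sumEmb_toSumLeft, sumEmb_mk]⟩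
  · rintro _ ⟨F, rfl⟩
    exact ⟨toSumRight i₀ (sumEmb i₀ i₁) F, sumEmb_toSumRight F⟩

/-- The factor `2` leaves room above the infimum defining the quotient norm, except for `F = 0`. -/
theorem exists_decomposition_norm_le (F : SumSpace i₀ i₁) :
    ∃ x₀ x₁, i₀ x₀ + i₁ x₁ = sumEmb i₀ i₁ F ∧ ‖x₀‖ₑ + ‖x₁‖ₑ ≤ 2 * ‖F‖ₑ := by
  rcases eq_or_ne F 0 with rfl | hF
  · exact ⟨0, 0, by simp, by simp⟩
  · obtain ⟨p, rfl, hp⟩ := Submodule.Quotient.norm_mk_lt F (norm_pos_iff.2 hF)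
    refine ⟨p.fst, p.snd, (sumEmb_mk p).symm, ?_⟩
    rw [WithLp.prod_norm_eq_of_L1] at hp
    rw [← ofReal_norm, ← ofReal_norm, ← ofReal_norm, ← ENNReal.ofReal_add (norm_nonneg _)
      (norm_nonneg _), ← ENNReal.ofReal_ofNat, ← ENNReal.ofReal_mul zero_le_two]
    exact ENNReal.ofReal_le_ofReal (by linarith)

theorem peetreK_sum_le (f : E) (t : ℝ) :
    peetreK i₀ (sumEmb i₀ i₁) f t ≤ peetreK i₀ i₁ f t := by
  refine le_peetreK fun x₀ x₁ hx => (peetreK_le (x₀ := x₀) (x₁ := toSumRight i₀ i₁ x₁) ?_).trans ?_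
  · rw [sumEmb_toSumRight, hx]
  · gcongr
    rw [← ofReal_norm, ← ofReal_norm]
    exact ENNReal.ofReal_le_ofReal (norm_toSumRight_le _)

/-- Decompose the `X₀ + X₁` part nearly optimally and move its `X₀` component to `x₀`; this is
affordable since `‖y₀‖ ≤ t ‖y₀‖` for `t ≥ 1`. -/
theorem peetreK_le_two_mul_sum (f : E) {t : ℝ} (ht : 1 ≤ t) :
    peetreK i₀ i₁ f t ≤ 2 * peetreK i₀ (sumEmb i₀ i₁) f t := by
  rw [← ENNReal.div_le_iff' two_ne_zero ENNReal.ofNat_ne_top]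
  refine le_peetreK fun x₀ F hx => ?_
  rw [ENNReal.div_le_iff' two_ne_zero ENNReal.ofNat_ne_top]
  obtain ⟨y₀, y₁, hy, hle⟩ := exists_decomposition_norm_le F
  have ht' : (1 : ℝ≥0∞) ≤ ENNReal.ofReal t := ENNReal.one_le_ofReal.2 ht
  calc peetreK i₀ i₁ f t ≤ ‖x₀ + y₀‖ₑ + ENNReal.ofReal t * ‖y₁‖ₑ :=
        peetreK_le (by rw [map_add, add_assoc, hy, hx])
    _ ≤ ‖x₀‖ₑ + ‖y₀‖ₑ + ENNReal.ofReal t * ‖y₁‖ₑ := by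
        gcongr
        exact enorm_add_le _ _
    _ ≤ ‖x₀‖ₑ + ENNReal.ofReal t * ‖y₀‖ₑ + ENNReal.ofReal t * ‖y₁‖ₑ := by
        gcongr
        exact le_mul_of_one_le_left zero_le ht'
    _ = ‖x₀‖ₑ + ENNReal.ofReal t * (‖y₀‖ₑ + ‖y₁‖ₑ) := by ring
    _ ≤ 2 * ‖x₀‖ₑ + ENNReal.ofReal t * (2 * ‖F‖ₑ) := by
        gcongr
        exact le_mul_of_one_le_left zero_le one_le_two
    _ = 2 * (‖x₀‖ₑ + ENNReal.ofReal t * ‖F‖ₑ) := by ring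

/-- All of `f` is put into the second space, whose norm is `K(f, 1; X₀, X₁)`. -/
theorem peetreK_sum_le_mul (f : E) {t : ℝ} (ht : 0 < t) :
    peetreK i₀ (sumEmb i₀ i₁) f t ≤ ENNReal.ofReal t * peetreK i₀ i₁ f 1 := by
  have ht' : ENNReal.ofReal t ≠ 0 := by simpa using ht
  rw [← ENNReal.div_le_iff' ht' ENNReal.ofReal_ne_top]
  refine le_peetreK fun x₀ x₁ hx => ?_
  rw [ENNReal.div_le_iff' ht' ENNReal.ofReal_ne_top]
  refine (peetreK_le (x₀ := 0) (x₁ := toSumLeft i₀ i₁ x₀ + toSumRight i₀ i₁ x₁) ?_).trans ?_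
  · rw [map_zero, zero_add, map_add, sumEmb_toSumLeft, sumEmb_toSumRight, hx]
  · rw [enorm_zero, zero_add, ENNReal.ofReal_one, one_mul]
    have h : ‖toSumLeft i₀ i₁ x₀ + toSumRight i₀ i₁ x₁‖ ≤ ‖x₀‖ + ‖x₁‖ :=
      norm_add_le_of_le (norm_toSumLeft_le _) (norm_toSumRight_le _)
    rw [← ofReal_norm, ← ofReal_norm, ← ofReal_norm,
      ← ENNReal.ofReal_add (norm_nonneg _) (norm_nonneg _)]
    exact mul_le_mul_right (ENNReal.ofReal_le_ofReal h) _

theorem spaceK_coincides_spaceK_sum {b B : ℝ → ℝ} {L D : ℝ} (hb2 : 0 < b 2)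
    (hb_anti : AntitoneOn b (Ioi 0)) (hL : ∀ t, 0 < t → b t ≤ L) (hD : ∀ t, 0 < t → t < 1 → t * B t ≤ D)
    (hbB : ∀ t, 1 ≤ t → B t = b t) :
    (spaceK i₀ i₁ 0 ∞ fun x => ENNReal.ofReal (b x)).Coincides
      (spaceK i₀ (sumEmb i₀ i₁) 0 ∞ fun x => ENNReal.ofReal (B x)) := by
  have hLpos : 0 < L := hb2.trans_le (hL 2 two_pos)
  have hb12 : ∀ t ∈ Ioo (1 : ℝ) 2, b 2 ≤ b t := fun t ht =>
    hb_anti (mem_Ioi.2 (one_pos.trans ht.1)) (mem_Ioi.2 two_pos) ht.2.le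
  have hdiv : ∀ {K N : ℝ≥0∞}, ENNReal.ofReal (b 2) * K ≤ N → K ≤ ENNReal.ofReal (b 2)⁻¹ * N := by
    intro K N h
    calc K = ENNReal.ofReal (b 2)⁻¹ * (ENNReal.ofReal (b 2) * K) := by
          rw [← mul_assoc, ← ENNReal.ofReal_mul (by positivity), inv_mul_cancel₀ hb2.ne',
            ENNReal.ofReal_one, one_mul]
      _ ≤ _ := by gcongr
  have hle : ∀ f : E, weightedNorm 0 ∞ (fun x => ENNReal.ofReal (B x))
      (peetreK i₀ (sumEmb i₀ i₁) f) ≤ ENNReal.ofReal (max 1 (D * (b 2)⁻¹)) *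
        weightedNorm 0 ∞ (fun x => ENNReal.ofReal (b x)) (peetreK i₀ i₁ f) := by
    intro f
    set N := weightedNorm 0 ∞ (fun x => ENNReal.ofReal (b x)) (peetreK i₀ i₁ f) with hN
    have hae := weightedNorm_zero_top_le_iff.1 hN.ge
    -- A good point in `(1, 2)`, where `b ≥ b 2`, controls `K(f, 1)` and thereby everything on `(0,
    -- 1)`.
    obtain ⟨r, hr, hrN⟩ := exists_mem_Ioo_of_ae hae zero_le_one one_lt_two
    have hK1 : peetreK i₀ i₁ f 1 ≤ ENNReal.ofReal (b 2)⁻¹ * N := by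
      refine hdiv (le_trans ?_ hrN)
      gcongr
      · exact hb12 r hr
      · exact peetreK_mono f hr.1.le
    rw [weightedNorm_zero_top_le_iff]
    filter_upwards [hae, ae_restrict_mem measurableSet_Ioi] with t ht ht0
    rcases le_or_gt 1 t with h1 | h1
    · rw [hbB t h1]
      calc _ ≤ ENNReal.ofReal (b t) * peetreK i₀ i₁ f t := by
            gcongr
            exact peetreK_sum_le f t
        _ ≤ N := ht
        _ ≤ _ := le_mul_of_one_le_left zero_le (ENNReal.one_le_ofReal.2 (le_max_left _ _))
    · calc _ ≤ ENNReal.ofReal (B t) * (ENNReal.ofReal t * (ENNReal.ofReal (b 2)⁻¹ * N)) := by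
            gcongr
            exact (peetreK_sum_le_mul f ht0).trans (by gcongr)
        _ = ENNReal.ofReal (t * B t * (b 2)⁻¹) * N := by
            rw [ENNReal.ofReal_mul' (by positivity), ENNReal.ofReal_mul (le_of_lt ht0)]
            ring
        _ ≤ _ := by
            gcongr
            exact (mul_le_mul_of_nonneg_right (hD t ht0 h1) (by positivity)).trans (le_max_right _ _)
  have hge : ∀ f : E, weightedNorm 0 ∞ (fun x => ENNReal.ofReal (b x)) (peetreK i₀ i₁ f) ≤
      ENNReal.ofReal (2 * max 1 (L * (b 2)⁻¹)) * weightedNorm 0 ∞ (fun x => ENNReal.ofReal (B x))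
        (peetreK i₀ (sumEmb i₀ i₁) f) := by
    intro f
    set N := weightedNorm 0 ∞ (fun x => ENNReal.ofReal (B x)) (peetreK i₀ (sumEmb i₀ i₁) f) with hN
    have hae := weightedNorm_zero_top_le_iff.1 hN.ge
    obtain ⟨r, hr, hrN⟩ := exists_mem_Ioo_of_ae hae zero_le_one one_lt_two
    simp only [hbB r hr.1.le] at hrN
    have hK1 : peetreK i₀ i₁ f 1 ≤ 2 * (ENNReal.ofReal (b 2)⁻¹ * N) := by
      calc peetreK i₀ i₁ f 1 ≤ peetreK i₀ i₁ f r := peetreK_mono f hr.1.le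
        _ ≤ 2 * peetreK i₀ (sumEmb i₀ i₁) f r := peetreK_le_two_mul_sum f hr.1.le
        _ ≤ _ := by
          gcongr
          refine hdiv (le_trans ?_ hrN)
          gcongr
          exact hb12 r hr
    rw [weightedNorm_zero_top_le_iff, ENNReal.ofReal_mul zero_le_two, ENNReal.ofReal_ofNat]
    filter_upwards [hae, ae_restrict_mem measurableSet_Ioi] with t ht ht0
    rcases le_or_gt 1 t with h1 | h1
    · rw [hbB t h1] at ht
      calc _ ≤ ENNReal.ofReal (b t) * (2 * peetreK i₀ (sumEmb i₀ i₁) f t) := by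
            gcongr
            exact peetreK_le_two_mul_sum f h1
        _ = 2 * 1 * (ENNReal.ofReal (b t) * peetreK i₀ (sumEmb i₀ i₁) f t) := by ring
        _ ≤ _ := by
            gcongr
            exact ENNReal.one_le_ofReal.2 (le_max_left _ _)
    · calc _ ≤ ENNReal.ofReal L * (2 * (ENNReal.ofReal (b 2)⁻¹ * N)) := by
            gcongr
            · exact hL t ht0
            · exact (peetreK_mono f h1.le).trans hK1
        _ = 2 * ENNReal.ofReal (L * (b 2)⁻¹) * N := by
            rw [ENNReal.ofReal_mul hLpos.le]
            ring
        _ ≤ _ := by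
            gcongr
            exact le_max_right _ _
  have hpos : 0 < 2 * max 1 (L * (b 2)⁻¹) := by positivity
  refine ⟨?_, (2 * max 1 (L * (b 2)⁻¹))⁻¹, max 1 (D * (b 2)⁻¹), by positivity,
    by positivity, fun f _ => ⟨?_, hle f⟩⟩
  · ext f
    simp only [spaceK, range_sumEmb_sum, mem_ofPred_eq]
    exact and_congr_right fun _ =>
      ⟨fun h => (hle f).trans_lt (ENNReal.mul_lt_top ENNReal.ofReal_lt_top h),
        fun h => (hge f).trans_lt (ENNReal.mul_lt_top ENNReal.ofReal_lt_top h)⟩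
  · change _ * weightedNorm 0 ∞ _ _ ≤ weightedNorm 0 ∞ _ _
    refine (mul_le_mul_right (hge f) _).trans (le_of_eq ?_)
    rw [← mul_assoc, ← ENNReal.ofReal_mul (by positivity), inv_mul_cancel₀ hpos.ne',
      ENNReal.ofReal_one, one_mul]

end Couple

/-! ### Reciprocals of slowly varying functions -/

/-- The growth bound for `1/B` is the quasi-monotonicity of `√t B(t)` rearranged. On `[x, y]` the
inverse is controlled by the lower bound `B y`. -/
theorem isGrowth_inv {B : ℝ → ℝ} (hpos : ∀ t, 0 < t → 0 < B t) (hanti : StrictAntiOn B (Ioi 0))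
    (hac : AbsContPos B) (hzero : Tendsto B (𝓝[>] 0) atTop) (htop : Tendsto B atTop (𝓝 0))
    (hsqrt : ∃ C : ℝ, 0 < C ∧ ∀ t r, 0 < t → t ≤ r → √t * B t ≤ C * (√r * B r)) :
    IsGrowth fun x => (B x)⁻¹ where
  pos t ht := inv_pos.2 (hpos t ht)
  strictMono s hs t ht hst := inv_strictAnti₀ (hpos t ht) (hanti hs ht hst)
  absCont x y hx hxy := by
    refine absolutelyContinuousOnInterval_inv (hpos y (hx.trans_le hxy)) (hac x y hx hxy)
      fun t ht => ?_
    rw [uIcc_of_le hxy] at ht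
    exact hanti.antitoneOn (mem_Ioi.2 (hx.trans_le ht.1)) (mem_Ioi.2 (hx.trans_le hxy)) ht.2
  zero := tendsto_inv_atTop_zero.comp hzero
  top := by
    refine Tendsto.inv_tendsto_nhdsGT_zero (tendsto_nhdsWithin_iff.2 ⟨htop, ?_⟩)
    filter_upwards [eventually_gt_atTop 0] with t ht using hpos t ht
  growth := by
    obtain ⟨C, hC, h⟩ := hsqrt
    refine ⟨C, hC, fun t r ht htr => ?_⟩
    have hr := ht.trans_le htr
    have h1 := h t r ht htr
    have hBt := hpos t ht
    have hBr := hpos r hr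
    have hst := Real.sqrt_pos.2 ht
    rw [Real.sqrt_div' _ ht.le, inv_le_iff_one_le_mul₀ hBr]
    calc 1 = √t * B t / (√t * B t) := by rw [div_self (by positivity)]
      _ ≤ C * (√r * B r) / (√t * B t) := by gcongr
      _ = _ := by field_simp

/-- `B` and `1/B` are differentiable at the same points; elsewhere both derivatives take the default
value `0`. -/
theorem deriv_inv_of_pos {B : ℝ → ℝ} {x : ℝ} (hx : 0 < B x) :
    deriv (fun y => (B y)⁻¹) x = -deriv B x / B x ^ 2 := by
  by_cases h : DifferentiableAt ℝ B x
  · exact deriv_fun_inv'' h hx.ne'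
  · rw [deriv_zero_of_not_differentiableAt h, deriv_zero_of_not_differentiableAt, neg_zero, zero_div]
    intro h'
    exact h (by simpa using h'.fun_inv (inv_ne_zero hx.ne'))

theorem sqrt_quasi_monotone_of_glued {b β B : ℝ → ℝ} {c : ℝ} (hb : SlowlyVarying b)
    (hβ : SlowlyVarying β) (hc : 0 < c) (hlarge : ∀ x, 1 ≤ x → B x = b x)
    (hsmall : ∀ x, 0 < x → x ≤ 1 → B x = c * β x) :
    ∃ C : ℝ, 0 < C ∧ ∀ t r, 0 < t → t ≤ r → √t * B t ≤ C * (√r * B r) := by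
  obtain ⟨C₁, hC₁, h₁⟩ := hb.sqrt_quasi_monotone
  obtain ⟨C₂, hC₂, h₂⟩ := hβ.sqrt_quasi_monotone
  have h₂' : ∀ t r, 0 < t → t ≤ r → r ≤ 1 → √t * B t ≤ C₂ * (√r * B r) := by
    intro t r ht htr hr
    rw [hsmall t ht (htr.trans hr), hsmall r (ht.trans_le htr) hr]
    calc √t * (c * β t) = c * (√t * β t) := by ring
      _ ≤ c * (C₂ * (√r * β r)) := by gcongr c * ?_; exact h₂ t r ht htr
      _ = _ := by ring
  have h₁' : ∀ t r, 1 ≤ t → t ≤ r → √t * B t ≤ C₁ * (√r * B r) := by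
    intro t r ht htr
    rw [hlarge t ht, hlarge r (ht.trans htr)]
    exact h₁ t r (one_pos.trans_le ht) htr
  have hB : ∀ r, 0 < r → 0 < √r * B r := by
    intro r hr
    refine mul_pos (Real.sqrt_pos.2 hr) ?_
    rcases le_or_gt 1 r with h | h
    · rw [hlarge r h]
      exact hb.pos r hr
    · rw [hsmall r hr h.le]
      exact mul_pos hc (hβ.pos r hr)
  -- The product serves `t < 1 ≤ r`, where the comparison passes through the point `1`.
  refine ⟨C₁ + C₂ + C₂ * C₁, by positivity, fun t r ht htr => ?_⟩
  have hr := hB r (ht.trans_le htr)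
  have e1 : 0 < C₁ * (√r * B r) := mul_pos hC₁ hr
  have e2 : 0 < C₂ * (√r * B r) := mul_pos hC₂ hr
  have e3 : 0 < C₂ * (C₁ * (√r * B r)) := mul_pos hC₂ e1
  rcases le_or_gt 1 t with h | h
  · linarith [h₁' t r h htr]
  · rcases le_or_gt 1 r with h' | h'
    · linarith [h₂' t 1 ht h.le le_rfl, mul_le_mul_of_nonneg_left (h₁' 1 r le_rfl h') hC₂.le]
    · linarith [h₂' t r ht htr h'.le]

theorem AbsContPos.eq_at_one_of_glued {β B : ℝ → ℝ} {c : ℝ} (hβ : AbsContPos β)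
    (hB : AbsContPos B) (hsmall : ∀ x, 0 < x → x < 1 → B x = c * β x) : B 1 = c * β 1 := by
  have h1 := (hB.continuousOn.continuousAt (Ioi_mem_nhds one_pos)).tendsto.mono_left
    (nhdsWithin_le_nhds (s := Iio 1))
  have h2 := ((hβ.continuousOn.continuousAt (Ioi_mem_nhds one_pos)).tendsto.mono_left
    (nhdsWithin_le_nhds (s := Iio 1))).const_mul c
  refine tendsto_nhds_unique h1 (h2.congr' ?_)
  filter_upwards [Ioo_mem_nhdsLT one_pos] with x hx
  exact (hsmall x hx.1 hx.2).symm

theorem strictAntiOn_of_glued {b β B : ℝ → ℝ} {c : ℝ} (hb : StrictAntiOn b (Ioi 0))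
    (hβ : StrictAntiOn β (Ioi 0)) (hc : 0 < c) (hlarge : ∀ x, 1 ≤ x → B x = b x)
    (hsmall : ∀ x, 0 < x → x ≤ 1 → B x = c * β x) : StrictAntiOn B (Ioi 0) := by
  have h1 : StrictAntiOn B (Ioc 0 1) := by
    intro x hx y hy hxy
    rw [hsmall x hx.1 hx.2, hsmall y hy.1 hy.2]
    exact mul_lt_mul_of_pos_left (hβ hx.1 hy.1 hxy) hc
  have h2 : StrictAntiOn B (Ici 1) := by
    intro x hx y hy hxy
    rw [hlarge x hx, hlarge y hy]
    exact hb (mem_Ioi.2 (one_pos.trans_le hx)) (mem_Ioi.2 (one_pos.trans_le hy)) hxy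
  have h := h1.union h2 (isGreatest_Ioc one_pos) isLeast_Ici
  rwa [Ioc_union_Ici_eq_Ioi one_pos] at h

end LimitingInterpolation

end

theorem theorem1p15 {X₀ X₁ E : Type*}
    [NormedAddCommGroup X₀] [NormedSpace ℝ X₀] [CompleteSpace X₀]
    [NormedAddCommGroup X₁] [NormedSpace ℝ X₁] [CompleteSpace X₁]
    [AddCommGroup E] [Module ℝ E] [TopologicalSpace E] [IsTopologicalAddGroup E]
    [ContinuousSMul ℝ E] [T2Space E]
    (i₀ : X₀ →L[ℝ] E) (i₁ : X₁ →L[ℝ] E)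
    (hi₀ : Function.Injective i₀) (hi₁ : Function.Injective i₁)
    (b β B : ℝ → ℝ) (A : ℝ → ℝ≥0∞) (c : ℝ)
    (hb : LimitingInterpolation.SlowlyVarying b) (hb_ac : LimitingInterpolation.AbsContPos b)
    (hb_anti : StrictAntiOn b (Ioi 0))
    (hb_zero : ∃ L : ℝ, Tendsto b (𝓝[>] 0) (𝓝 L)) (hb_top : Tendsto b atTop (𝓝 0))
    (hβ : LimitingInterpolation.SlowlyVarying β) (hβ_ac : LimitingInterpolation.AbsContPos β)
    (hβ_anti : StrictAntiOn β (Ioi 0))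
    (hβ_zero : Tendsto β (𝓝[>] 0) atTop) (hβ_top : Tendsto β atTop (𝓝 0))
    (hc : 0 < c)
    (hB_large : ∀ x, 1 ≤ x → B x = b x) (hB_small : ∀ x, 0 < x → x < 1 → B x = c * β x)
    (hB_ac : LimitingInterpolation.AbsContPos B)
    (hA : ∀ᵐ x ∂(volume.restrict (Ioi (0 : ℝ))),
      A x = ENNReal.ofReal (B x ^ 2) / ENNReal.ofReal (x * -deriv B x)) :
    (LimitingInterpolation.spaceK i₀ i₁ 0 ∞ (fun x => ENNReal.ofReal (b x))).Coincides
        (LimitingInterpolation.spaceK i₀ (LimitingInterpolation.sumEmb i₀ i₁) 0 ∞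
          (fun x => ENNReal.ofReal (B x))) ∧
      (LimitingInterpolation.spaceK i₀ (LimitingInterpolation.sumEmb i₀ i₁) 0 ∞
          (fun x => ENNReal.ofReal (B x))).Coincides
        (LimitingInterpolation.spaceJ i₀ (LimitingInterpolation.sumEmb i₀ i₁) 0 ∞ A) := by
  have hB_one : B 1 = c * β 1 := hβ_ac.eq_at_one_of_glued hB_ac hB_small
  have hsmall : ∀ x, 0 < x → x ≤ 1 → B x = c * β x := by
    intro x hx hx1
    rcases hx1.lt_or_eq with h | rfl
    · exact hB_small x hx h
    · exact hB_one
  have hB_pos : ∀ x, 0 < x → 0 < B x := by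
    intro x hx
    rcases le_total 1 x with h | h
    · rw [hB_large x h]
      exact hb.pos x hx
    · rw [hsmall x hx h]
      exact mul_pos hc (hβ.pos x hx)
  have hB_zero : Tendsto B (𝓝[>] 0) atTop := by
    refine (hβ_zero.const_mul_atTop hc).congr' ?_
    filter_upwards [Ioo_mem_nhdsGT one_pos] with x hx
    exact (hB_small x hx.1 hx.2).symm
  have hB_top : Tendsto B atTop (𝓝 0) := by
    refine hb_top.congr' ?_
    filter_upwards [eventually_ge_atTop 1] with x hx
    exact (hB_large x hx).symm
  have hG := LimitingInterpolation.isGrowth_inv hB_pos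
    (LimitingInterpolation.strictAntiOn_of_glued hb_anti hβ_anti hc hB_large hsmall) hB_ac hB_zero
    hB_top (LimitingInterpolation.sqrt_quasi_monotone_of_glued hb hβ hc hB_large hsmall)
  constructor
  · obtain ⟨L, hL⟩ := hb_zero
    obtain ⟨D, hD, hβD⟩ := hβ.exists_mul_le
    refine LimitingInterpolation.spaceK_coincides_spaceK_sum (L := L) (D := c * D) (hb.pos 2 two_pos)
      hb_anti.antitoneOn (fun t ht => ?_) (fun t ht ht1 => ?_) hB_large
    · refine ge_of_tendsto hL ?_
      filter_upwards [Ioo_mem_nhdsGT ht] with s hs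
      exact (hb_anti hs.1 ht hs.2).le
    · rw [hB_small t ht ht1, mul_left_comm]
      exact mul_le_mul_of_nonneg_left (hβD t ht ht1.le) hc.le
  · have h := hG.spaceK_coincides_spaceJ (i₀ := i₀) (i₁ := LimitingInterpolation.sumEmb i₀ i₁)
      (A := A) ?_
    · simpa only [inv_inv] using h
    -- Inverting `x (-B') / B²` is legitimate even where `B' = 0`, because `B²` is finite and
    -- nonzero.
    · filter_upwards [hA, ae_restrict_mem measurableSet_Ioi] with x hx hx0
      have hBx := hB_pos x hx0
      rw [hx, LimitingInterpolation.deriv_inv_of_pos hBx, ← mul_div_assoc,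
        ENNReal.ofReal_div_of_pos (by positivity), ENNReal.inv_div (Or.inl ENNReal.ofReal_ne_top)
          (Or.inl (by simpa using hBx.ne'))]
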